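/- **Setting.** Let $a_0,a_1,a_2\in\mathbb C$ be such that $x^3+a_2x^2+a_1x+a_0$ has roots $\lambda,\lambda_1,\lambda_2$ with pairwise distinct real parts. Put $\gamma_i=\lambda_i-\lambda$, $\alpha_i=\operatorname{Re}\gamma_i$ $(i=1,2)$, $\Gamma_1=\lambda_1-\lambda_2$, $\Gamma_2=\lambda_2-\lambda_1$. For $\operatorname{Re}\omega\neq0$ let $g_\omega(t,s)=-\operatorname{sgn}(\operatorname{Re}\omega)\,e^{\omega(t-s)}$ if $\operatorname{sgn}(\operatorname{Re}\omega)(t-s)<0$ and $g_\omega(t,s)=0$ otherwise, and set $$G_\omega[f](t)=\int_{-\infty}^\infty g_\omega(t,s)f(s)\,ds,\quad I_\omega[f](t)=\int_{-\infty}^\infty|g_\omega(t,s)f(s)|\,ds,\quad G[f]=\sum_{j=1}^2\frac1{\Gamma_j}G_{\gamma_j}[f].$$ All functions are from $\mathbb R$ to $\mathbb C$. $BC$ is the space of bounded continuous functions; $BC_0=\{f\in BC: f(t)\to0,\ t\to+\infty\}$; $C_{00}=\{f\in BC_0: f(t)\to0,\ t\to-\infty\}$; for $p\ge1$, $L^p_0$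 is the set of (measurable) $f$ bounded on $(-\infty,0]$ with $\int_0^\infty|f|^p<\infty$. $\mathcal{AP}$ is the set of (Bochner) almost periodic functions: continuous $f$ such that every sequence of translates $f(\cdot+b_k)$ has a subsequence converging uniformly on $\mathbb R$. A function in $BC$ belongs to $\mathcal{AAP}$ (resp. $\mathcal{AAP}_0$, $\mathcal{AP}(\mathbb R,\mathbb C,p)$, $\mathcal{AP}_0(\mathbb R,\mathbb C,p)$) if it is a sum $\phi+g$ with $\phi\in\mathcal{AP}$ and $g(t)\to0$ as $t\to+\infty$ (resp. $g(t)\to0$ as $t\to\pm\infty$, $g\in L^p_0$, $g\in L^p(\mathbb R)$). **Theorem.** Consider $$y'''+(a_2+r_2(t))y''+(a_1+r_1(t))y'+(a_0+r_0(t))y=0\qquad(t\in\mathbb R)\tag{1}$$ with $r_i=\mu_i+\nu_i\in\mathcal{AAP}$ (resp. $\mathcal{AAP}_0$, $\mathcal{AP}(\mathbb R,\mathbb C,p)$, $\mathcal{AP}_0(\mathbb R,\mathbb C,p)$), $\mu_i\in\mathcal{AP}$ and $\nu_i\in BC_0$ (resp. $C_{00}$, $L^p_0$, $L^p(\mathbb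 R)$), $i=0,1,2$, $p\ge 1$. Assume that there is a differentiable $\theta\in\mathcal{AP}$ with $$\theta=-G\big[\lambda^2\mu_2+\lambda\mu_1+\mu_0+(2\lambda\mu_2+\mu_1)\theta+\mu_2\theta'+(3\lambda+a_2+\mu_2)\theta^2+3\theta\theta'+\theta^3\big].\tag{2}$$ Put $$P_\nu(\theta;\lambda)=\lambda^2\nu_2+\lambda\nu_1+\nu_0+(2\lambda\nu_2+\nu_1)\theta+\nu_2\theta'+\nu_2\theta^2,$$ $$r_\theta=2\lambda r_2+r_1+2(3\lambda+a_2+r_2)\theta+3\theta^2+3\theta',$$ and, for $0\le\beta<\min\{|\alpha_1|,|\alpha_2|\}$, with $\beta_i=\alpha_i-\operatorname{sgn}(\alpha_i)\beta$, $$L_{\beta,\theta}=\sum_{i=1}^2\frac{1+|\gamma_i|}{|\lambda_1-\lambda_2|}\Big[\|I_{\beta_i}[r_\theta]\|_\infty+\|I_{\beta_i}[r_2+3\theta]\|_\infty\Big],$$ $$Q_{\beta,\theta}=\sum_{i=1}^2\frac{1+|\gamma_i|}{|\lambda_1-\lambda_2|}\Big[\frac{1+3|\lambda|+|a_2|}{|\beta_i|}+\|I_{\beta_i}[r_2+3\theta]\|_\infty\Big].$$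 Assume $L_{0,\theta}<1$ and, with $M_\theta=\frac13\Big(\sqrt{1+\frac{1-L_{0,\theta}}{Q_{0,\theta}}}-1\Big)$, $$\|G[P_\nu(\theta;\lambda)]\|_\infty+\|G[P_\nu(\theta;\lambda)]'\|_\infty\le M_\theta\Big[\tfrac23(1-L_{0,\theta})-Q_{0,\theta}M_\theta\Big].$$ Then there are a function $\psi$, the function $z=\theta+\psi$, and a solution $y$ of (1) such that, with $$F=\lambda^2r_2+\lambda r_1+r_0+(2\lambda r_2+r_1)z+r_2z'+(3\lambda+a_2+r_2)z^2+3zz'+z^3,$$ $$y(t)=e^{\lambda t}\exp\Big(-\gamma_1^{-1}\gamma_2^{-1}\int_0^tF(s)\,ds\Big)\exp\Big(-\sum_{j=1}^2\frac1{\Gamma_j\gamma_j}G_{\gamma_j}[F](t)\Big),\qquad z=-G[F],$$ $z,z'\in\mathcal{AAP}$ (resp. $\mathcal{AAP}_0$, $\mathcal{AP}(\mathbb R,\mathbb C,p)$, $\mathcal{AP}_0(\mathbb R,\mathbb C,p)$), and $\psi$ is $C^1$ with $\psi,\psi'\in BC_0$ (resp. $C_{00}$, $L^p_0$, $L^p(\mathbb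 R)$) and $$\psi=-G\big[P_\nu(\theta;\lambda)+r_\theta\psi+(r_2+3\theta)\psi'+(3\lambda+3\theta+a_2+r_2)\psi^2+3\psi\psi'+\psi^3\big].\tag{3}$$ Moreover, for every $0<\beta<\min\{|\alpha_1|,|\alpha_2|\}$ with $L_{\beta,\theta}<\frac12$, $\psi,\psi'=O\big((I_\beta+I_{-\beta})[P_\nu(\theta;\lambda)]\big)$ uniformly on $\mathbb R$. -/

import Mathlib

open MeasureTheory Filter Topology
open scoped ENNReal

noncomputable section

namespace PoincarePerron

/-! ## Function spaces (all functions are `ℝ → ℂ`) -/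

/-- `BC`: bounded continuous functions. -/
def BC : Set (ℝ → ℂ) := {f | Continuous f ∧ ∃ C : ℝ, ∀ t, ‖f t‖ ≤ C}

/-- `BC₀`: bounded continuous functions vanishing at `+∞`. -/
def BC0 : Set (ℝ → ℂ) := {f | f ∈ BC ∧ Tendsto f atTop (𝓝 0)}

/-- `C₀₀`: functions of `BC₀` that also vanish at `-∞`. -/
def C00 : Set (ℝ → ℂ) := {f | f ∈ BC0 ∧ Tendsto f atBot (𝓝 0)}

/-- `L^p(ℝ)` (as functions, not as classes). -/
def LpLine (p : ℝ) : Set (ℝ → ℂ) := {f | MemLp f (ENNReal.ofReal p) volume}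

/-- `L^p_0`: (measurable) functions bounded on `(-∞,0]` and `p`-integrable on `[0,∞)`. -/
def Lp0 (p : ℝ) : Set (ℝ → ℂ) :=
  {f | AEStronglyMeasurable f volume ∧ (∃ C : ℝ, ∀ t ≤ 0, ‖f t‖ ≤ C) ∧
    MemLp f (ENNReal.ofReal p) (volume.restrict (Set.Ici 0))}

/-- Bochner almost periodic functions: continuous, and every sequence of translates has a
uniformly convergent subsequence. -/
def AP : Set (ℝ → ℂ) :=
  {f | Continuous f ∧ ∀ b : ℕ → ℝ, ∃ φ : ℕ → ℕ, StrictMono φ ∧ ∃ g : ℝ → ℂ,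
    TendstoUniformly (fun m t => f (t + b (φ m))) g atTop}

/-- Bounded continuous functions of the form `φ + g` with `φ` almost periodic and `g ∈ V`. -/
def APplus (V : Set (ℝ → ℂ)) : Set (ℝ → ℂ) :=
  {f | f ∈ BC ∧ ∃ φ ∈ AP, ∃ g ∈ V, f = φ + g}

/-- The four settings: perturbations of the almost periodic part in
`BC₀`, `C₀₀`, `L^p_0` or `L^p(ℝ)`. -/
inductive Setting
  | bc0
  | c00
  | lp0
  | lp

/-- The class of decaying functions in each setting. -/
def Setting.decaying (p : ℝ) : Setting → Set (ℝ → ℂ)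
  | .bc0 => BC0
  | .c00 => C00
  | .lp0 => Lp0 p
  | .lp => LpLine p

/-- The corresponding class of almost periodic type functions:
* `bc0`: asymptotically almost periodic functions `AAP`,
* `c00`: `AAP₀` (the remainder vanishes at both ends),
* `lp0`: `p`-almost periodic functions `AP(ℝ,ℂ,p)`,
* `lp`: `AP₀(ℝ,ℂ,p)` (the remainder is in `L^p(ℝ)`). -/
def Setting.apType (p : ℝ) : Setting → Set (ℝ → ℂ)
  | .bc0 => APplus {g | Tendsto g atTop (𝓝 0)}
  | .c00 => APplus {g | Tendsto g atTop (𝓝 0) ∧ Tendsto g atBot (𝓝 0)}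
  | .lp0 => APplus (Lp0 p)
  | .lp => APplus (LpLine p)

/-! ## Green operators -/

/-- The scalar Green kernel `g_ω(t,s)`, for `Re ω ≠ 0`. -/
def greenKernel (ω : ℂ) (t s : ℝ) : ℂ :=
  if Real.sign ω.re * (t - s) < 0 then
    -((Real.sign ω.re : ℝ) : ℂ) * Complex.exp (ω * ((t : ℂ) - (s : ℂ)))
  else 0

/-- `G_ω[f](t) = ∫ g_ω(t,s) f(s) ds`. -/
def scalarGreen (ω : ℂ) (f : ℝ → ℂ) (t : ℝ) : ℂ := ∫ s, greenKernel ω t s * f s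

/-- `I_ω[f](t) = ∫ |g_ω(t,s) f(s)| ds`, with values in `[0,∞]`. -/
def absGreen (ω : ℂ) (f : ℝ → ℂ) (t : ℝ) : ℝ≥0∞ := ∫⁻ s, ‖greenKernel ω t s * f s‖ₑ

/-- The Green operator of `(d/dt - γ₁)(d/dt - γ₂)`:
`G[f] = Γ₁⁻¹ G_{γ₁}[f] + Γ₂⁻¹ G_{γ₂}[f]`, `Γ₁ = γ₁ - γ₂ = -Γ₂`. -/
def green (γ₁ γ₂ : ℂ) (f : ℝ → ℂ) (t : ℝ) : ℂ :=
  (γ₁ - γ₂)⁻¹ * scalarGreen γ₁ f t + (γ₂ - γ₁)⁻¹ * scalarGreen γ₂ f t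

/-- The supremum norm, with values in `[0,∞]`. -/
def supNorm (f : ℝ → ℂ) : ℝ≥0∞ := ⨆ t, ‖f t‖ₑ

/-- `‖I_{α - sgn(α)β}[f]‖_∞` where `α = Re γ`, with values in `[0,∞]`. -/
def supAbsGreen (β : ℝ) (γ : ℂ) (f : ℝ → ℂ) : ℝ≥0∞ :=
  ⨆ t, absGreen ((γ.re - Real.sign γ.re * β : ℝ) : ℂ) f t

/-! ## The third order equation and its Riccati type equation

Coefficients `a₀, a₁, a₂` and `r₀, r₁, r₂` are indexed by `Fin 3`. -/

/-- `P(a;x) = x³ + a₂x² + a₁x + a₀`. -/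
def charPoly (a : Fin 3 → ℂ) : Polynomial ℂ :=
  Polynomial.X ^ 3 + Polynomial.C (a 2) * Polynomial.X ^ 2 + Polynomial.C (a 1) * Polynomial.X
    + Polynomial.C (a 0)

/-- `y''' + (a₂+r₂)y'' + (a₁+r₁)y' + (a₀+r₀)y = 0` on `ℝ`. -/
def IsSolution (a : Fin 3 → ℂ) (r : Fin 3 → ℝ → ℂ) (y : ℝ → ℂ) : Prop :=
  ContDiff ℝ 3 y ∧ ∀ t, iteratedDeriv 3 y t + (a 2 + r 2 t) * iteratedDeriv 2 y t
    + (a 1 + r 1 t) * deriv y t + (a 0 + r 0 t) * y t = 0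

/-- `P(r;λ) = λ²r₂ + λr₁ + r₀`. -/
def pertPoly (r : Fin 3 → ℝ → ℂ) (lam : ℂ) (t : ℝ) : ℂ :=
  lam ^ 2 * r 2 t + lam * r 1 t + r 0 t

/-- `𝓛(·,z) = r₂z' + (2λr₂ + r₁)z`. -/
def linTerm (r : Fin 3 → ℝ → ℂ) (lam : ℂ) (z : ℝ → ℂ) (t : ℝ) : ℂ :=
  r 2 t * deriv z t + (2 * lam * r 2 t + r 1 t) * z t

/-- `𝓕(·,z,z') = (a₂ + r₂ + 3λ)z² + 3zz' + z³`. -/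
def nonlinTerm (a : Fin 3 → ℂ) (r : Fin 3 → ℝ → ℂ) (lam : ℂ) (z : ℝ → ℂ) (t : ℝ) : ℂ :=
  (a 2 + r 2 t + 3 * lam) * z t ^ 2 + 3 * z t * deriv z t + z t ^ 3

/-- `P(r;λ) + 𝓛(·,z) + 𝓕(·,z,z')`. -/
def riccatiTerm (a : Fin 3 → ℂ) (r : Fin 3 → ℝ → ℂ) (lam : ℂ) (z : ℝ → ℂ) (t : ℝ) : ℂ :=
  pertPoly r lam t + linTerm r lam z t + nonlinTerm a r lam z t

/-- `z` is differentiable and satisfies the integral equation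
`z = -G[P(r;λ) + 𝓛(·,z) + 𝓕(·,z,z')]`; here `γᵢ = λᵢ - λ`. -/
def SolvesRiccati (a : Fin 3 → ℂ) (r : Fin 3 → ℝ → ℂ) (lam lam₁ lam₂ : ℂ) (z : ℝ → ℂ) : Prop :=
  Differentiable ℝ z ∧
    ∀ t, z t = -green (lam₁ - lam) (lam₂ - lam) (riccatiTerm a r lam z) t

/-- `P_ν(θ;λ) = λ²ν₂ + λν₁ + ν₀ + (2λν₂+ν₁)θ + ν₂θ' + ν₂θ²`. -/
def pNu (ν : Fin 3 → ℝ → ℂ) (lam : ℂ) (θ : ℝ → ℂ) (t : ℝ) : ℂ :=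
  lam ^ 2 * ν 2 t + lam * ν 1 t + ν 0 t + (2 * lam * ν 2 t + ν 1 t) * θ t + ν 2 t * deriv θ t
    + ν 2 t * θ t ^ 2

/-- `r_θ = 2λr₂ + r₁ + 2(3λ+a₂+r₂)θ + 3θ² + 3θ'`. -/
def rTheta (a : Fin 3 → ℂ) (r : Fin 3 → ℝ → ℂ) (lam : ℂ) (θ : ℝ → ℂ) (t : ℝ) : ℂ :=
  2 * lam * r 2 t + r 1 t + 2 * (3 * lam + a 2 + r 2 t) * θ t + 3 * θ t ^ 2 + 3 * deriv θ t

/-- The expression inside `-G[·]` in the equation for the decaying part `ψ`. -/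
def psiTerm (a : Fin 3 → ℂ) (r ν : Fin 3 → ℝ → ℂ) (lam : ℂ) (θ ψ : ℝ → ℂ) (t : ℝ) : ℂ :=
  pNu ν lam θ t + rTheta a r lam θ t * ψ t + (r 2 t + 3 * θ t) * deriv ψ t
    + (3 * lam + 3 * θ t + a 2 + r 2 t) * ψ t ^ 2 + 3 * ψ t * deriv ψ t + ψ t ^ 3

/-! ## The smallness constants -/

/-- The weight `(1 + |γ|) / |λ₁ - λ₂|`. -/
def weight (lam₁ lam₂ γ : ℂ) : ℝ≥0∞ := ENNReal.ofReal ((1 + ‖γ‖) / ‖lam₁ - lam₂‖)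

/-- The summand of `L_{β,θ}` belonging to `γ`. -/
def Lsummand (a : Fin 3 → ℂ) (r : Fin 3 → ℝ → ℂ) (lam lam₁ lam₂ : ℂ) (β : ℝ) (θ : ℝ → ℂ)
    (γ : ℂ) : ℝ≥0∞ :=
  weight lam₁ lam₂ γ *
    (supAbsGreen β γ (rTheta a r lam θ) + supAbsGreen β γ (fun t => r 2 t + 3 * θ t))

/-- `L_{β,θ}`, with values in `[0,∞]`. -/
def Lconst (a : Fin 3 → ℂ) (r : Fin 3 → ℝ → ℂ) (lam lam₁ lam₂ : ℂ) (β : ℝ) (θ : ℝ → ℂ) : ℝ≥0∞ :=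
  Lsummand a r lam lam₁ lam₂ β θ (lam₁ - lam) + Lsummand a r lam lam₁ lam₂ β θ (lam₂ - lam)

/-- The summand of `Q_{β,θ}` belonging to `γ`. -/
def Qsummand (a : Fin 3 → ℂ) (r : Fin 3 → ℝ → ℂ) (lam lam₁ lam₂ : ℂ) (β : ℝ) (θ : ℝ → ℂ)
    (γ : ℂ) : ℝ≥0∞ :=
  weight lam₁ lam₂ γ *
    (ENNReal.ofReal ((1 + 3 * ‖lam‖ + ‖a 2‖) / |γ.re - Real.sign γ.re * β|)
      + supAbsGreen β γ (fun t => r 2 t + 3 * θ t))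

/-- `Q_{β,θ}`, with values in `[0,∞]`; it is finite if `r₂` and `θ` are bounded. -/
def Qconst (a : Fin 3 → ℂ) (r : Fin 3 → ℝ → ℂ) (lam lam₁ lam₂ : ℂ) (β : ℝ) (θ : ℝ → ℂ) : ℝ≥0∞ :=
  Qsummand a r lam lam₁ lam₂ β θ (lam₁ - lam) + Qsummand a r lam lam₁ lam₂ β θ (lam₂ - lam)

/-- `M = (1/3)(√(1 + (1-L)/Q) - 1)`. -/
def Mconst (L Q : ℝ) : ℝ := (1 / 3) * (Real.sqrt (1 + (1 - L) / Q) - 1)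

/-- `M[(2/3)(1-L) - QM]` for the above `M`, the bound in the smallness condition. -/
def smallnessBound (L Q : ℝ) : ℝ := Mconst L Q * ((2 / 3) * (1 - L) - Q * Mconst L Q)

/-- The formula for the solution `y` in terms of `z`, where `F = P(r;λ) + 𝓛(·,z) + 𝓕(·,z,z')`. -/
def solutionFormula (lam γ₁ γ₂ : ℂ) (F : ℝ → ℂ) (t : ℝ) : ℂ :=
  Complex.exp (lam * t) * Complex.exp (-(γ₁⁻¹ * γ₂⁻¹ * ∫ s in (0 : ℝ)..t, F s)) *
    Complex.exp (-(1 / ((γ₁ - γ₂) * γ₁) * scalarGreen γ₁ F t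
      + 1 / ((γ₂ - γ₁) * γ₂) * scalarGreen γ₂ F t))

end PoincarePerron

end

open PoincarePerron

namespace PoincarePerron

/-! ## The Green kernels -/

/-! If y'/y = λ + z, the third order equation becomes z'' - (γ₁+γ₂)z' + γ₁γ₂z + F = 0, because
P(λ+x) = x(x-γ₁)(x-γ₂). Since neither γᵢ is purely imaginary, G inverts (D-γ₁)(D-γ₂) on bounded
functions, and a bounded solution of z = -G[F] gives y (`isSolution_of_logDeriv`,
`isSolution_solutionFormula`). Writing z = θ + ψ and subtracting the equation of θ leaves the
equation for ψ (`riccatiTerm_add`).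

The pair (ψ, ψ') is found by Banach's theorem in a ball of radius M (`exists_fixedPoint_pair`).
Everything is measured through one positive operator, `majorant`, which dominates |Gf| + |(Gf)'|.
The constants L and Q bound it on the linear coefficients and on the coefficients of the
nonlinearity, and M is chosen so that L + Q(9M²+6M) = 1.

Decay is not built into the fixed point space. It follows from a comparison principle: m = |ψ| +
|ψ'| satisfies m ≤ majorant |P_ν| + majorant (W m), where W has majorant at most q < 1. This bound
survives a small exponential twist of the kernels (`exists_twist_majorant_lt_one`). A twisted
contraction gives m ≤ C E with E = e^{-β|·|} * |P_ν| (`le_expConv_of_le_majorant`), and all four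
decaying classes are stable under such domination (`mem_decaying_of_le_expConv`). Once m is known to
follow |P_ν| at some rate, the nonlinear part can be split into a small linear term and a multiple
of E, so a prescribed β only needs a contractive linear part (`pair_le_expConv`).

Since θ is only assumed differentiable, θ' has to be shown bounded, continuous and almost periodic
beforehand. Finiteness of L makes the Green potentials of θ' bounded, and the integral equation then
bootstraps the regularity (`exists_absGreen_deriv_le`, `SolvesRiccati.regularity`, `deriv_mem_AP`).
-/

theorem greenKernel_of_neg {ω : ℂ} (h : ω.re < 0) (t s : ℝ) :
    greenKernel ω t s = (Set.Iio t).indicator (fun s : ℝ => Complex.exp (ω * ((t : ℂ) - s))) s := by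
  by_cases hs : s < t
  · simp [greenKernel, Real.sign_of_neg h, hs]
  · simp [greenKernel, Real.sign_of_neg h, hs]

theorem greenKernel_of_pos {ω : ℂ} (h : 0 < ω.re) (t s : ℝ) :
    greenKernel ω t s = (Set.Ioi t).indicator (fun s : ℝ => -Complex.exp (ω * ((t : ℂ) - s))) s := by
  by_cases hs : t < s
  · simp [greenKernel, Real.sign_of_pos h, hs]
  · simp [greenKernel, Real.sign_of_pos h, hs]

theorem measurable_greenKernel (ω : ℂ) (t : ℝ) : Measurable (greenKernel ω t) := by
  unfold greenKernel
  refine Measurable.ite ?_ (by fun_prop) measurable_const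
  exact measurableSet_lt (by fun_prop) measurable_const

theorem integrable_greenKernel_mul {ω : ℂ} {f : ℝ → ℂ} {t : ℝ} (hf : AEStronglyMeasurable f volume)
    (h : absGreen ω f t ≠ ⊤) : Integrable (fun s => greenKernel ω t s * f s) :=
  ⟨(measurable_greenKernel ω t).aestronglyMeasurable.mul hf, lt_top_iff_ne_top.2 h⟩

theorem absGreen_eq (ω : ℂ) (f : ℝ → ℂ) (t : ℝ) :
    absGreen ω f t = ∫⁻ s, ‖greenKernel ω t s‖ₑ * ‖f s‖ₑ := by
  simp [absGreen, enorm_mul]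

theorem enorm_scalarGreen_le (ω : ℂ) (f : ℝ → ℂ) (t : ℝ) :
    ‖scalarGreen ω f t‖ₑ ≤ absGreen ω f t := enorm_integral_le_lintegral_enorm _

theorem cexp_mul_sub (ω : ℂ) (t s : ℝ) :
    Complex.exp (ω * ((t : ℂ) - s)) = Complex.exp (ω * t) * Complex.exp (-(ω * s)) := by
  rw [← Complex.exp_add]; ring_nf

/-- Variation of constants: the Green operator is `e^{ωt}` times a primitive of `e^{-ωs} f(s)`. -/
theorem scalarGreen_eq_exp_mul {ω : ℂ} (hω : ω.re ≠ 0) {f : ℝ → ℂ}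
    (hf : AEStronglyMeasurable f volume) (h : ∀ t, absGreen ω f t ≠ ⊤) :
    (∀ a b : ℝ, IntervalIntegrable (fun s : ℝ => Complex.exp (-(ω * s)) * f s) volume a b) ∧
    ∀ t : ℝ, scalarGreen ω f t = Complex.exp (ω * t) *
      (scalarGreen ω f 0 + ∫ s in (0 : ℝ)..t, Complex.exp (-(ω * s)) * f s) := by
  set k : ℝ → ℂ := fun s => Complex.exp (-(ω * s)) * f s with hk
  rcases lt_or_gt_of_ne hω with hneg | hpos
  · have key (t : ℝ) : (fun s => greenKernel ω t s * f s) =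
        (Set.Iio t).indicator (fun s => Complex.exp (ω * t) * k s) := by
      ext s
      rw [greenKernel_of_neg hneg]
      by_cases hs : s ∈ Set.Iio t
      · simp only [Set.indicator_of_mem hs, hk, cexp_mul_sub]; ring
      · simp [Set.indicator_of_notMem hs]
    have hint (t : ℝ) : IntegrableOn k (Set.Iic t) := by
      have h1 := integrable_greenKernel_mul hf (h t)
      rw [key t, integrable_indicator_iff measurableSet_Iio] at h1
      have h2 := Integrable.const_mul h1 (Complex.exp (-(ω * t)))
      rw [integrableOn_Iic_iff_integrableOn_Iio]
      refine h2.congr (ae_of_all _ fun s => ?_)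
      simp only
      rw [← mul_assoc, ← Complex.exp_add]; simp
    have hG (t : ℝ) : scalarGreen ω f t = Complex.exp (ω * t) * ∫ s in Set.Iic t, k s := by
      unfold scalarGreen
      rw [key t, integral_indicator measurableSet_Iio, integral_const_mul, integral_Iic_eq_integral_Iio]
    refine ⟨fun a b => ?_, fun t => ?_⟩
    · rw [intervalIntegrable_iff]
      exact (hint (max a b)).mono_set fun x hx => hx.2
    · rw [hG t, hG 0, ← intervalIntegral.integral_Iic_sub_Iic (hint 0) (hint t)]
      simp
  · have key (t : ℝ) : (fun s => greenKernel ω t s * f s) =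
        (Set.Ioi t).indicator (fun s => -Complex.exp (ω * t) * k s) := by
      ext s
      rw [greenKernel_of_pos hpos]
      by_cases hs : s ∈ Set.Ioi t
      · simp only [Set.indicator_of_mem hs, hk, cexp_mul_sub]; ring
      · simp [Set.indicator_of_notMem hs]
    have hint (t : ℝ) : IntegrableOn k (Set.Ioi t) := by
      have h1 := integrable_greenKernel_mul hf (h t)
      rw [key t, integrable_indicator_iff measurableSet_Ioi] at h1
      have h2 := Integrable.const_mul h1 (-Complex.exp (-(ω * t)))
      refine h2.congr (ae_of_all _ fun s => ?_)
      simp only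
      rw [← mul_assoc, neg_mul_neg, ← Complex.exp_add]; simp
    have hG (t : ℝ) : scalarGreen ω f t = -Complex.exp (ω * t) * ∫ s in Set.Ioi t, k s := by
      unfold scalarGreen
      rw [key t, integral_indicator measurableSet_Ioi, integral_const_mul]
    refine ⟨fun a b => ?_, fun t => ?_⟩
    · rw [intervalIntegrable_iff]
      exact (hint (min a b)).mono_set fun x hx => hx.1
    · rw [hG t, hG 0, ← intervalIntegral.integral_Ioi_sub_Ioi' (hint 0) (hint t)]
      simp only [Complex.ofReal_zero, mul_zero, Complex.exp_zero]
      ring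

theorem hasDerivAt_cexp_ofReal (ω : ℂ) (t : ℝ) :
    HasDerivAt (fun t : ℝ => Complex.exp (ω * t)) (ω * Complex.exp (ω * t)) t := by
  have h := ((Complex.ofRealCLM.hasDerivAt (x := t)).const_mul ω).cexp
  simpa [mul_comm] using h

/-- Product rule in the variation of constants formula. The differentiability of the primitive is
left as an input so that it can come from continuity of f (everywhere) or from Lebesgue
differentiation (almost everywhere). -/
theorem hasDerivAt_scalarGreen_of_primitive {ω : ℂ} (hω : ω.re ≠ 0) {f : ℝ → ℂ}
    (hf : AEStronglyMeasurable f volume) (h : ∀ t, absGreen ω f t ≠ ⊤) {t : ℝ}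
    (hF : HasDerivAt (fun t : ℝ => ∫ s in (0 : ℝ)..t, Complex.exp (-(ω * s)) * f s)
      (Complex.exp (-(ω * t)) * f t) t) :
    HasDerivAt (scalarGreen ω f) (ω * scalarGreen ω f t + f t) t := by
  have e := (scalarGreen_eq_exp_mul hω hf h).2
  have h1 := (hasDerivAt_cexp_ofReal ω t).mul (hF.const_add (scalarGreen ω f 0))
  rw [funext e]
  refine h1.congr_deriv ?_
  rw [← mul_assoc (Complex.exp (ω * t)), ← Complex.exp_add]
  simp [mul_assoc]

theorem continuous_scalarGreen {ω : ℂ} (hω : ω.re ≠ 0) {f : ℝ → ℂ}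
    (hf : AEStronglyMeasurable f volume) (h : ∀ t, absGreen ω f t ≠ ⊤) :
    Continuous (scalarGreen ω f) := by
  obtain ⟨hi, e⟩ := scalarGreen_eq_exp_mul hω hf h
  rw [funext e]
  exact (by fun_prop : Continuous fun t : ℝ => Complex.exp (ω * t)).mul
    (continuous_const.add (intervalIntegral.continuous_primitive hi 0))

theorem hasDerivAt_scalarGreen {ω : ℂ} (hω : ω.re ≠ 0) {f : ℝ → ℂ} (hf : Continuous f)
    (h : ∀ t, absGreen ω f t ≠ ⊤) (t : ℝ) :
    HasDerivAt (scalarGreen ω f) (ω * scalarGreen ω f t + f t) t := by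
  refine hasDerivAt_scalarGreen_of_primitive hω hf.aestronglyMeasurable h ?_
  exact (by fun_prop : Continuous fun s : ℝ => Complex.exp (-(ω * s)) * f s).integral_hasStrictDerivAt
    0 t |>.hasDerivAt

/-- Needed for densities containing θ' before θ' is known to be continuous. -/
theorem ae_hasDerivAt_scalarGreen {ω : ℂ} (hω : ω.re ≠ 0) {f : ℝ → ℂ}
    (hf : AEStronglyMeasurable f volume) (h : ∀ t, absGreen ω f t ≠ ⊤) :
    ∀ᵐ t : ℝ, HasDerivAt (scalarGreen ω f) (ω * scalarGreen ω f t + f t) t := by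
  have hi := (scalarGreen_eq_exp_mul hω hf h).1
  have hl : LocallyIntegrable (fun s : ℝ => Complex.exp (-(ω * s)) * f s) volume := by
    refine fun x => ⟨Set.Icc (x - 1) (x + 1), Icc_mem_nhds (by linarith) (by linarith), ?_⟩
    exact (intervalIntegrable_iff_integrableOn_Icc_of_le (by linarith)).1 (hi _ _)
  filter_upwards [_root_.LocallyIntegrable.ae_hasDerivAt_integral hl] with t ht
  exact hasDerivAt_scalarGreen_of_primitive hω hf h (ht 0)

/-! ## Integrals of the kernels -/

theorem norm_cexp_mul_sub (ω : ℂ) (t s : ℝ) :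
    ‖Complex.exp (ω * ((t : ℂ) - s))‖ = Real.exp (ω.re * (t - s)) := by
  rw [← Complex.ofReal_sub, Complex.norm_exp, Complex.re_mul_ofReal]

theorem norm_greenKernel {ω : ℂ} (hω : ω.re ≠ 0) (t s : ℝ) :
    ‖greenKernel ω t s‖ =
      if Real.sign ω.re * (t - s) < 0 then Real.exp (-(|ω.re| * |t - s|)) else 0 := by
  rcases lt_or_gt_of_ne hω with h | h
  · by_cases hs : s < t
    · have : 0 < t - s := by linarith
      simp [greenKernel, Real.sign_of_neg h, hs, norm_cexp_mul_sub, abs_of_neg h, abs_of_pos this]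
    · simp [greenKernel, Real.sign_of_neg h, hs]
  · by_cases hs : t < s
    · have : t - s < 0 := by linarith
      simp [greenKernel, Real.sign_of_pos h, hs, norm_cexp_mul_sub, abs_of_pos h, abs_of_neg this,
        ← mul_neg]
    · simp [greenKernel, Real.sign_of_pos h, hs]

theorem enorm_greenKernel {ω : ℂ} (hω : ω.re ≠ 0) (t s : ℝ) :
    ‖greenKernel ω t s‖ₑ = if Real.sign ω.re * (t - s) < 0 then
      ENNReal.ofReal (Real.exp (-(|ω.re| * |t - s|))) else 0 := by
  rw [← ofReal_norm, norm_greenKernel hω]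
  split_ifs <;> simp

theorem lintegral_enorm_greenKernel {ω : ℂ} (hω : ω.re ≠ 0) (t : ℝ) :
    ∫⁻ s, ‖greenKernel ω t s‖ₑ = ENNReal.ofReal (1 / |ω.re|) := by
  rcases lt_or_gt_of_ne hω with h | h
  · have e : (fun s => ‖greenKernel ω t s‖ₑ) = (Set.Iio t).indicator
        fun s => ENNReal.ofReal (Real.exp (ω.re * t) * Real.exp (-ω.re * s)) := by
      ext s
      rw [greenKernel_of_neg h, enorm_indicator_eq_indicator_enorm]
      congr 1; ext s
      rw [← ofReal_norm, norm_cexp_mul_sub, ← Real.exp_add]; ring_nf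
    have hi : IntegrableOn (fun s => Real.exp (ω.re * t) * Real.exp (-ω.re * s)) (Set.Iio t) :=
      ((integrableOn_exp_mul_Iic (neg_pos.2 h) t).mono_set Set.Iio_subset_Iic_self).const_mul _
    rw [e, lintegral_indicator measurableSet_Iio,
      ← ofReal_integral_eq_lintegral_ofReal hi (ae_of_all _ fun s => by positivity),
      integral_const_mul, ← integral_Iic_eq_integral_Iio, integral_exp_mul_Iic (neg_pos.2 h),
      mul_div_assoc', ← Real.exp_add, abs_of_neg h]
    simp
  · have e : (fun s => ‖greenKernel ω t s‖ₑ) = (Set.Ioi t).indicator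
        fun s => ENNReal.ofReal (Real.exp (ω.re * t) * Real.exp (-ω.re * s)) := by
      ext s
      rw [greenKernel_of_pos h, enorm_indicator_eq_indicator_enorm]
      congr 1; ext s
      rw [enorm_neg, ← ofReal_norm, norm_cexp_mul_sub, ← Real.exp_add]; ring_nf
    have hi : IntegrableOn (fun s => Real.exp (ω.re * t) * Real.exp (-ω.re * s)) (Set.Ioi t) :=
      (integrableOn_exp_mul_Ioi (neg_lt_zero.2 h) t).const_mul _
    rw [e, lintegral_indicator measurableSet_Ioi,
      ← ofReal_integral_eq_lintegral_ofReal hi (ae_of_all _ fun s => by positivity),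
      integral_const_mul, integral_exp_mul_Ioi (neg_lt_zero.2 h),
      mul_div_assoc', mul_neg, ← Real.exp_add, abs_of_pos h]
    simp

theorem absGreen_le_of_bound {ω : ℂ} (hω : ω.re ≠ 0) {f : ℝ → ℂ} {C : ℝ≥0∞}
    (h : ∀ t, ‖f t‖ₑ ≤ C) (t : ℝ) : absGreen ω f t ≤ ENNReal.ofReal (1 / |ω.re|) * C := by
  rw [absGreen_eq, ← lintegral_enorm_greenKernel hω t,
    ← lintegral_mul_const _ (measurable_greenKernel ω t).enorm]
  exact lintegral_mono fun s => by gcongr; exact h s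

theorem absGreen_ne_top_of_bound {ω : ℂ} (hω : ω.re ≠ 0) {f : ℝ → ℂ} {C : ℝ}
    (h : ∀ t, ‖f t‖ ≤ C) (t : ℝ) : absGreen ω f t ≠ ⊤ := by
  refine ne_top_of_le_ne_top (ENNReal.mul_ne_top ENNReal.ofReal_ne_top ENNReal.ofReal_ne_top)
    (absGreen_le_of_bound hω (C := ENNReal.ofReal C) (fun t => ?_) t)
  rw [← ofReal_norm]
  exact ENNReal.ofReal_le_ofReal (h t)

/-! ## The exponentially twisted kernels -/

/-- The modulus of the kernel of `Re γ - sgn(Re γ) β`. -/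
noncomputable def twistedKernel (β : ℝ) (γ : ℂ) (t s : ℝ) : ℝ≥0∞ :=
  ‖greenKernel ((γ.re - Real.sign γ.re * β : ℝ) : ℂ) t s‖ₑ

theorem measurable_twistedKernel (β : ℝ) (γ : ℂ) (t : ℝ) : Measurable (twistedKernel β γ t) :=
  (measurable_greenKernel _ t).enorm

/-- With β < |x| the twist moves x towards 0 without crossing it, so the twisted kernel keeps its
supporting half line and only decays more slowly. -/
theorem sign_twist {β x : ℝ} (hx0 : x ≠ 0) (h : β < |x|) :
    |x - Real.sign x * β| = |x| - β ∧ Real.sign (x - Real.sign x * β) = Real.sign x := by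
  rcases lt_trichotomy x 0 with hx | hx | hx
  · rw [abs_of_neg hx] at h ⊢
    have : x - Real.sign x * β < 0 := by rw [Real.sign_of_neg hx]; linarith
    rw [Real.sign_of_neg this, abs_of_neg this, Real.sign_of_neg hx]
    exact ⟨by ring, rfl⟩
  · exact absurd hx hx0
  · rw [abs_of_pos hx] at h ⊢
    have : 0 < x - Real.sign x * β := by rw [Real.sign_of_pos hx]; linarith
    rw [Real.sign_of_pos this, abs_of_pos this, Real.sign_of_pos hx]
    exact ⟨by ring, rfl⟩

theorem twistedKernel_eq {β : ℝ} {γ : ℂ} (hγ : γ.re ≠ 0) (hβ : β < |γ.re|) (t s : ℝ) :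
    twistedKernel β γ t s = if Real.sign γ.re * (t - s) < 0 then
      ENNReal.ofReal (Real.exp (-((|γ.re| - β) * |t - s|))) else 0 := by
  obtain ⟨h1, h2⟩ := sign_twist hγ hβ
  unfold twistedKernel
  rw [enorm_greenKernel, Complex.ofReal_re, h1, h2]
  rw [Complex.ofReal_re, ← abs_pos, h1]
  linarith

theorem twistedKernel_zero (γ : ℂ) (hγ : γ.re ≠ 0) (t s : ℝ) :
    twistedKernel 0 γ t s = ‖greenKernel γ t s‖ₑ := by
  rw [twistedKernel_eq hγ (abs_pos.2 hγ), enorm_greenKernel hγ, sub_zero]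

theorem lintegral_twistedKernel {β : ℝ} {γ : ℂ} (hγ : γ.re ≠ 0) (hβ : β < |γ.re|) (t : ℝ) :
    ∫⁻ s, twistedKernel β γ t s = ENNReal.ofReal (1 / |γ.re - Real.sign γ.re * β|) := by
  unfold twistedKernel
  rw [lintegral_enorm_greenKernel, Complex.ofReal_re]
  rw [Complex.ofReal_re, ← abs_pos, (sign_twist hγ hβ).1]
  linarith

/-- The kernel absorbs a growth factor e^{β|t-s|} by lowering its rate by β; this is the origin of
the exponents βᵢ. -/
theorem twistedKernel_mul_exp {β : ℝ} {γ : ℂ} (hγ : γ.re ≠ 0) (hβ : β < |γ.re|)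
    (t s : ℝ) : twistedKernel 0 γ t s * ENNReal.ofReal (Real.exp (β * |t - s|)) =
      twistedKernel β γ t s := by
  rw [twistedKernel_eq hγ hβ, twistedKernel_eq hγ (abs_pos.2 hγ)]
  split_ifs
  · rw [← ENNReal.ofReal_mul (by positivity), ← Real.exp_add]
    ring_nf
  · simp

theorem twistedKernel_zero_le {β : ℝ} {γ : ℂ} (hγ : γ.re ≠ 0) (hβ : β ≤ |γ.re|)
    (t s : ℝ) : twistedKernel 0 γ t s ≤ ENNReal.ofReal (Real.exp (-(β * |t - s|))) := by
  rw [twistedKernel_eq hγ (abs_pos.2 hγ), sub_zero]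
  split_ifs
  · gcongr
  · simp

/-- Convexity of the exponential, in the twisting parameter. -/
theorem twistedKernel_convex {β τ : ℝ} {γ : ℂ} (hγ : γ.re ≠ 0) (h0 : 0 ≤ β) (hβ : β < |γ.re|)
    (h0τ : 0 ≤ τ) (h1τ : τ ≤ 1) (t s : ℝ) :
    twistedKernel (τ * β) γ t s ≤ twistedKernel 0 γ t s + ENNReal.ofReal τ * twistedKernel β γ t s := by
  have hτβ : τ * β ≤ β := mul_le_of_le_one_left h0 h1τ
  rw [← twistedKernel_mul_exp hγ hβ, ← twistedKernel_mul_exp hγ (hτβ.trans_lt hβ),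
    mul_left_comm, ← mul_one_add]
  gcongr
  rw [← ENNReal.ofReal_mul h0τ, ← ENNReal.ofReal_one, ← ENNReal.ofReal_add zero_le_one (by positivity)]
  gcongr
  -- With x = β|t-s|, convexity between 0 and x gives e^{τx} ≤ (1-τ) + τeˣ ≤ 1 + τeˣ.
  have h := convexOn_exp.2 (Set.mem_univ 0) (Set.mem_univ (β * |t - s|)) (sub_nonneg.2 h1τ) h0τ
    (by ring)
  simp only [smul_eq_mul, mul_zero, zero_add, Real.exp_zero, mul_one, ← mul_assoc] at h
  linarith

/-! ## The Green operator of the second order equation -/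

/-- The derivative of `green γ₁ γ₂ f`. -/
noncomputable def greenDeriv (γ₁ γ₂ : ℂ) (f : ℝ → ℂ) (t : ℝ) : ℂ :=
  γ₁ * (γ₁ - γ₂)⁻¹ * scalarGreen γ₁ f t + γ₂ * (γ₂ - γ₁)⁻¹ * scalarGreen γ₂ f t

/-- A positive operator dominating `|G f| + |(G f)'|`, with exponentially twisted kernels. -/
noncomputable def majorant (γ₁ γ₂ : ℂ) (β : ℝ) (h : ℝ → ℝ≥0∞) (t : ℝ) : ℝ≥0∞ :=
  weight γ₁ γ₂ γ₁ * (∫⁻ s, twistedKernel β γ₁ t s * h s) +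
    weight γ₁ γ₂ γ₂ * ∫⁻ s, twistedKernel β γ₂ t s * h s

theorem weight_ne_top (γ₁ γ₂ γ : ℂ) : weight γ₁ γ₂ γ ≠ ⊤ := ENNReal.ofReal_ne_top

theorem weight_pos {γ₁ γ₂ : ℂ} (h : γ₁ ≠ γ₂) (γ : ℂ) : 0 < weight γ₁ γ₂ γ := by
  have : 0 < ‖γ₁ - γ₂‖ := norm_pos_iff.2 (sub_ne_zero.2 h)
  exact ENNReal.ofReal_pos.2 (by positivity)

theorem majorant_mono {γ₁ γ₂ : ℂ} {β : ℝ} {h k : ℝ → ℝ≥0∞} (hk : ∀ s, h s ≤ k s) (t : ℝ) :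
    majorant γ₁ γ₂ β h t ≤ majorant γ₁ γ₂ β k t := by
  unfold majorant
  gcongr <;> exact hk _

theorem majorant_add {γ₁ γ₂ : ℂ} {β : ℝ} {h : ℝ → ℝ≥0∞} (hh : Measurable h) (k : ℝ → ℝ≥0∞) (t : ℝ) :
    majorant γ₁ γ₂ β (fun s => h s + k s) t = majorant γ₁ γ₂ β h t + majorant γ₁ γ₂ β k t := by
  unfold majorant
  have hm (γ : ℂ) : Measurable fun s => twistedKernel β γ t s * h s :=
    (measurable_twistedKernel β γ t).mul hh
  simp_rw [mul_add]
  rw [lintegral_add_left (hm γ₁), lintegral_add_left (hm γ₂)]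
  ring

theorem majorant_const_mul {γ₁ γ₂ : ℂ} {β : ℝ} {c : ℝ≥0∞} (hc : c ≠ ⊤) (h : ℝ → ℝ≥0∞) (t : ℝ) :
    majorant γ₁ γ₂ β (fun s => c * h s) t = c * majorant γ₁ γ₂ β h t := by
  unfold majorant
  simp_rw [mul_left_comm _ c]
  rw [lintegral_const_mul' _ _ hc, lintegral_const_mul' _ _ hc]
  ring

theorem majorant_ne_top {γ₁ γ₂ : ℂ} (h₁ : γ₁.re ≠ 0) (h₂ : γ₂.re ≠ 0) {β : ℝ} (hβ₁ : β < |γ₁.re|)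
    (hβ₂ : β < |γ₂.re|) {h : ℝ → ℝ≥0∞} {C : ℝ≥0∞} (hC : C ≠ ⊤) (hh : ∀ s, h s ≤ C) :
    ∃ D : ℝ≥0∞, D ≠ ⊤ ∧ ∀ t, majorant γ₁ γ₂ β h t ≤ D := by
  refine ⟨weight γ₁ γ₂ γ₁ * (ENNReal.ofReal (1 / |γ₁.re - Real.sign γ₁.re * β|) * C) +
    weight γ₁ γ₂ γ₂ * (ENNReal.ofReal (1 / |γ₂.re - Real.sign γ₂.re * β|) * C), ?_, fun t => ?_⟩
  · finiteness [weight_ne_top γ₁ γ₂ γ₁, weight_ne_top γ₁ γ₂ γ₂]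
  · unfold majorant
    rw [← lintegral_twistedKernel h₁ hβ₁ t, ← lintegral_twistedKernel h₂ hβ₂ t,
      ← lintegral_mul_const _ (measurable_twistedKernel β γ₁ t),
      ← lintegral_mul_const _ (measurable_twistedKernel β γ₂ t)]
    gcongr <;> exact hh _

/-- In the weight 1 + |γ|, the 1 pays for the coefficient of `scalarGreen γ f` in G and the |γ| for
its coefficient in the derivative. -/
theorem enorm_green_add_enorm_greenDeriv_le {γ₁ γ₂ : ℂ} (h₁ : γ₁.re ≠ 0) (h₂ : γ₂.re ≠ 0)
    (f : ℝ → ℂ) (t : ℝ) :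
    ‖green γ₁ γ₂ f t‖ₑ + ‖greenDeriv γ₁ γ₂ f t‖ₑ ≤ majorant γ₁ γ₂ 0 (fun s => ‖f s‖ₑ) t := by
  have w (γ δ : ℂ) (hδ : ‖δ‖ = ‖γ₁ - γ₂‖) :
      weight γ₁ γ₂ γ = ‖δ⁻¹‖ₑ + ‖γ * δ⁻¹‖ₑ := by
    rw [weight, ← hδ, ← ofReal_norm, ← ofReal_norm, ← ENNReal.ofReal_add (by positivity) (by positivity),
      norm_mul, norm_inv]
    congr 1; ring
  have hI (γ : ℂ) (hγ : γ.re ≠ 0) :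
      ‖scalarGreen γ f t‖ₑ ≤ ∫⁻ s, twistedKernel 0 γ t s * ‖f s‖ₑ := by
    refine (enorm_scalarGreen_le γ f t).trans_eq ?_
    simp_rw [absGreen_eq, twistedKernel_zero γ hγ]
  unfold majorant green greenDeriv
  rw [w γ₁ (γ₁ - γ₂) rfl, w γ₂ (γ₂ - γ₁) (norm_sub_rev _ _)]
  calc _ ≤ (‖(γ₁ - γ₂)⁻¹‖ₑ * ‖scalarGreen γ₁ f t‖ₑ + ‖(γ₂ - γ₁)⁻¹‖ₑ * ‖scalarGreen γ₂ f t‖ₑ) +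
        (‖γ₁ * (γ₁ - γ₂)⁻¹‖ₑ * ‖scalarGreen γ₁ f t‖ₑ +
          ‖γ₂ * (γ₂ - γ₁)⁻¹‖ₑ * ‖scalarGreen γ₂ f t‖ₑ) := by
        simp_rw [← enorm_mul]
        gcongr <;> exact enorm_add_le _ _
    _ = (‖(γ₁ - γ₂)⁻¹‖ₑ + ‖γ₁ * (γ₁ - γ₂)⁻¹‖ₑ) * ‖scalarGreen γ₁ f t‖ₑ +
        (‖(γ₂ - γ₁)⁻¹‖ₑ + ‖γ₂ * (γ₂ - γ₁)⁻¹‖ₑ) * ‖scalarGreen γ₂ f t‖ₑ := by ring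
    _ ≤ _ := by gcongr <;> exact hI _ ‹_›

theorem scalarGreen_sub {ω : ℂ} {f g : ℝ → ℂ} {t : ℝ} (hf : AEStronglyMeasurable f volume)
    (hg : AEStronglyMeasurable g volume) (hft : absGreen ω f t ≠ ⊤) (hgt : absGreen ω g t ≠ ⊤) :
    scalarGreen ω (fun s => f s - g s) t = scalarGreen ω f t - scalarGreen ω g t := by
  unfold scalarGreen
  simp_rw [mul_sub]
  exact integral_sub (integrable_greenKernel_mul hf hft) (integrable_greenKernel_mul hg hgt)

/-- The two contributions of f cancel because Γ₁⁻¹ + Γ₂⁻¹ = 0. -/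
theorem hasDerivAt_green_of_scalarGreen {γ₁ γ₂ : ℂ} (h₁₂ : γ₁ ≠ γ₂) {f : ℝ → ℂ} {t : ℝ}
    (H₁ : HasDerivAt (scalarGreen γ₁ f) (γ₁ * scalarGreen γ₁ f t + f t) t)
    (H₂ : HasDerivAt (scalarGreen γ₂ f) (γ₂ * scalarGreen γ₂ f t + f t) t) :
    HasDerivAt (green γ₁ γ₂ f) (greenDeriv γ₁ γ₂ f t) t := by
  refine ((H₁.const_mul (γ₁ - γ₂)⁻¹).add (H₂.const_mul (γ₂ - γ₁)⁻¹)).congr_deriv ?_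
  have : γ₁ - γ₂ ≠ 0 := sub_ne_zero.2 h₁₂
  have e : (γ₂ - γ₁)⁻¹ = -(γ₁ - γ₂)⁻¹ := by rw [← neg_sub, inv_neg]
  rw [greenDeriv, e]
  ring

/-- Here f enters with coefficient (γ₁-γ₂)/(γ₁-γ₂) = 1, so G is a right inverse of (D-γ₁)(D-γ₂). -/
theorem hasDerivAt_greenDeriv_of_scalarGreen {γ₁ γ₂ : ℂ} (h₁₂ : γ₁ ≠ γ₂) {f : ℝ → ℂ} {t : ℝ}
    (H₁ : HasDerivAt (scalarGreen γ₁ f) (γ₁ * scalarGreen γ₁ f t + f t) t)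
    (H₂ : HasDerivAt (scalarGreen γ₂ f) (γ₂ * scalarGreen γ₂ f t + f t) t) :
    HasDerivAt (greenDeriv γ₁ γ₂ f)
      ((γ₁ + γ₂) * greenDeriv γ₁ γ₂ f t - γ₁ * γ₂ * green γ₁ γ₂ f t + f t) t := by
  refine ((H₁.const_mul (γ₁ * (γ₁ - γ₂)⁻¹)).add (H₂.const_mul (γ₂ * (γ₂ - γ₁)⁻¹))).congr_deriv ?_
  have : γ₁ - γ₂ ≠ 0 := sub_ne_zero.2 h₁₂
  have e : (γ₂ - γ₁)⁻¹ = -(γ₁ - γ₂)⁻¹ := by rw [← neg_sub, inv_neg]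
  rw [greenDeriv, green, e]
  field_simp
  ring

theorem continuous_greenDeriv {γ₁ γ₂ : ℂ} (h₁ : γ₁.re ≠ 0) (h₂ : γ₂.re ≠ 0) {f : ℝ → ℂ}
    (hf : AEStronglyMeasurable f volume) (H₁ : ∀ t, absGreen γ₁ f t ≠ ⊤)
    (H₂ : ∀ t, absGreen γ₂ f t ≠ ⊤) : Continuous (greenDeriv γ₁ γ₂ f) :=
  (continuous_const.mul (continuous_scalarGreen h₁ hf H₁)).add
    (continuous_const.mul (continuous_scalarGreen h₂ hf H₂))

/-- A differentiable function that is a Green potential of a possibly discontinuous density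
has the expected derivative everywhere. -/
theorem hasDerivAt_of_eq_neg_green {γ₁ γ₂ : ℂ} (h₁ : γ₁.re ≠ 0) (h₂ : γ₂.re ≠ 0) (h₁₂ : γ₁ ≠ γ₂)
    {f θ : ℝ → ℂ} (hf : AEStronglyMeasurable f volume) (H₁ : ∀ t, absGreen γ₁ f t ≠ ⊤)
    (H₂ : ∀ t, absGreen γ₂ f t ≠ ⊤) (hθ : Differentiable ℝ θ)
    (heq : ∀ t, θ t = -green γ₁ γ₂ f t) (t : ℝ) :
    HasDerivAt θ (-greenDeriv γ₁ γ₂ f t) t := by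
  have hc : Continuous fun t => -greenDeriv γ₁ γ₂ f t := (continuous_greenDeriv h₁ h₂ hf H₁ H₂).neg
  -- The density may be discontinuous, so the formula first holds almost everywhere, by Lebesgue
  -- differentiation.
  have hae : deriv θ =ᵐ[volume] fun t => -greenDeriv γ₁ γ₂ f t := by
    filter_upwards [ae_hasDerivAt_scalarGreen h₁ hf H₁, ae_hasDerivAt_scalarGreen h₂ hf H₂]
      with t ht₁ ht₂
    have := (hasDerivAt_green_of_scalarGreen h₁₂ ht₁ ht₂).neg
    rw [show θ = -green γ₁ γ₂ f from funext heq]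
    exact this.deriv
  have hint (a b : ℝ) : IntervalIntegrable (deriv θ) volume a b :=
    (hc.intervalIntegrable a b).congr_ae (ae_restrict_of_ae hae.symm)
  -- An everywhere differentiable function with integrable derivative is the integral of that
  -- derivative; hence θ is a primitive of a continuous function and the formula holds at every
  -- point.
  have hrep : θ = fun t => θ 0 + ∫ s in (0 : ℝ)..t, -greenDeriv γ₁ γ₂ f s := by
    ext t
    rw [← intervalIntegral.integral_congr_ae (hae.mono fun x hx _ => hx),
      intervalIntegral.integral_deriv_eq_sub (fun x _ => hθ x) (hint 0 t)]
    ring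
  rw [hrep]
  exact (hc.integral_hasStrictDerivAt 0 t).hasDerivAt.const_add _

/-! ## Bounded continuous and almost periodic functions -/

theorem const_mem_BC (c : ℂ) : (fun _ : ℝ => c) ∈ BC := ⟨continuous_const, ‖c‖, fun _ => le_rfl⟩

theorem add_mem_BC {f g : ℝ → ℂ} (hf : f ∈ BC) (hg : g ∈ BC) : (fun t => f t + g t) ∈ BC := by
  obtain ⟨hf, C, hC⟩ := hf
  obtain ⟨hg, D, hD⟩ := hg
  exact ⟨hf.add hg, C + D, fun t => (norm_add_le _ _).trans (add_le_add (hC t) (hD t))⟩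

theorem mul_mem_BC {f g : ℝ → ℂ} (hf : f ∈ BC) (hg : g ∈ BC) : (fun t => f t * g t) ∈ BC := by
  obtain ⟨hf, C, hC⟩ := hf
  obtain ⟨hg, D, hD⟩ := hg
  refine ⟨hf.mul hg, C * D, fun t => (norm_mul_le _ _).trans ?_⟩
  exact mul_le_mul (hC t) (hD t) (norm_nonneg _) ((norm_nonneg _).trans (hC t))

theorem const_mul_mem_BC (c : ℂ) {f : ℝ → ℂ} (hf : f ∈ BC) : (fun t => c * f t) ∈ BC :=
  mul_mem_BC (const_mem_BC c) hf

theorem neg_mem_BC {f : ℝ → ℂ} (hf : f ∈ BC) : (fun t => -f t) ∈ BC := by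
  simpa using const_mul_mem_BC (-1) hf

theorem sub_mem_BC {f g : ℝ → ℂ} (hf : f ∈ BC) (hg : g ∈ BC) : (fun t => f t - g t) ∈ BC := by
  simpa [sub_eq_add_neg] using add_mem_BC hf (neg_mem_BC hg)

theorem pow_mem_BC {f : ℝ → ℂ} (hf : f ∈ BC) (n : ℕ) : (fun t => f t ^ n) ∈ BC := by
  induction n with
  | zero => simpa using const_mem_BC 1
  | succ n ih => simpa [pow_succ] using mul_mem_BC ih hf

theorem exists_enorm_le_of_mem_BC {f : ℝ → ℂ} (hf : f ∈ BC) :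
    ∃ C : ℝ≥0∞, C ≠ ⊤ ∧ ∀ t, ‖f t‖ₑ ≤ C := by
  obtain ⟨-, C, hC⟩ := hf
  refine ⟨ENNReal.ofReal C, ENNReal.ofReal_ne_top, fun t => ?_⟩
  rw [← ofReal_norm]
  exact ENNReal.ofReal_le_ofReal (hC t)

theorem mem_BC_of_enorm_le {f : ℝ → ℂ} (hf : Continuous f) {C : ℝ≥0∞} (hC : C ≠ ⊤)
    (h : ∀ t, ‖f t‖ₑ ≤ C) : f ∈ BC := by
  refine ⟨hf, C.toReal, fun t => ?_⟩
  rw [← toReal_enorm]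
  exact ENNReal.toReal_mono hC (h t)

theorem absGreen_ne_top_of_mem_BC {ω : ℂ} (hω : ω.re ≠ 0) {f : ℝ → ℂ} (hf : f ∈ BC) (t : ℝ) :
    absGreen ω f t ≠ ⊤ :=
  absGreen_ne_top_of_bound hω hf.2.choose_spec t

theorem scalarGreen_mem_BC {ω : ℂ} (hω : ω.re ≠ 0) {f : ℝ → ℂ}
    (hf : AEStronglyMeasurable f volume) {C : ℝ≥0∞} (hC : C ≠ ⊤) (h : ∀ t, absGreen ω f t ≤ C) :
    scalarGreen ω f ∈ BC :=
  mem_BC_of_enorm_le (continuous_scalarGreen hω hf fun t => ne_top_of_le_ne_top hC (h t)) hC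
    fun t => (enorm_scalarGreen_le ω f t).trans (h t)

theorem scalarGreen_mem_BC_of_mem_BC {ω : ℂ} (hω : ω.re ≠ 0) {f : ℝ → ℂ} (hf : f ∈ BC) :
    scalarGreen ω f ∈ BC := by
  obtain ⟨C, hC, hfC⟩ := exists_enorm_le_of_mem_BC hf
  exact scalarGreen_mem_BC hω hf.1.aestronglyMeasurable
    (ENNReal.mul_ne_top ENNReal.ofReal_ne_top hC) (absGreen_le_of_bound hω hfC)

theorem green_mem_BC {γ₁ γ₂ : ℂ} (h₁ : γ₁.re ≠ 0) (h₂ : γ₂.re ≠ 0) {f : ℝ → ℂ} (hf : f ∈ BC) :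
    green γ₁ γ₂ f ∈ BC :=
  add_mem_BC (const_mul_mem_BC _ (scalarGreen_mem_BC_of_mem_BC h₁ hf))
    (const_mul_mem_BC _ (scalarGreen_mem_BC_of_mem_BC h₂ hf))

theorem greenDeriv_mem_BC {γ₁ γ₂ : ℂ} (h₁ : γ₁.re ≠ 0) (h₂ : γ₂.re ≠ 0) {f : ℝ → ℂ} (hf : f ∈ BC) :
    greenDeriv γ₁ γ₂ f ∈ BC :=
  add_mem_BC (const_mul_mem_BC _ (scalarGreen_mem_BC_of_mem_BC h₁ hf))
    (const_mul_mem_BC _ (scalarGreen_mem_BC_of_mem_BC h₂ hf))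

theorem hasDerivAt_green {γ₁ γ₂ : ℂ} (h₁ : γ₁.re ≠ 0) (h₂ : γ₂.re ≠ 0) (h₁₂ : γ₁ ≠ γ₂)
    {f : ℝ → ℂ} (hf : f ∈ BC) (t : ℝ) :
    HasDerivAt (green γ₁ γ₂ f) (greenDeriv γ₁ γ₂ f t) t :=
  hasDerivAt_green_of_scalarGreen h₁₂
    (hasDerivAt_scalarGreen h₁ hf.1 (absGreen_ne_top_of_mem_BC h₁ hf) t)
    (hasDerivAt_scalarGreen h₂ hf.1 (absGreen_ne_top_of_mem_BC h₂ hf) t)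

theorem hasDerivAt_greenDeriv {γ₁ γ₂ : ℂ} (h₁ : γ₁.re ≠ 0) (h₂ : γ₂.re ≠ 0) (h₁₂ : γ₁ ≠ γ₂)
    {f : ℝ → ℂ} (hf : f ∈ BC) (t : ℝ) : HasDerivAt (greenDeriv γ₁ γ₂ f)
      ((γ₁ + γ₂) * greenDeriv γ₁ γ₂ f t - γ₁ * γ₂ * green γ₁ γ₂ f t + f t) t :=
  hasDerivAt_greenDeriv_of_scalarGreen h₁₂
    (hasDerivAt_scalarGreen h₁ hf.1 (absGreen_ne_top_of_mem_BC h₁ hf) t)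
    (hasDerivAt_scalarGreen h₂ hf.1 (absGreen_ne_top_of_mem_BC h₂ hf) t)

/-- If |f(bₙ)| > n, the translates by bₙ have no subsequence converging even at 0. -/
theorem mem_BC_of_mem_AP {f : ℝ → ℂ} (hf : f ∈ AP) : f ∈ BC := by
  refine ⟨hf.1, ?_⟩
  by_contra! h
  choose b hb using fun n : ℕ => h n
  obtain ⟨φ, hφ, g, hg⟩ := hf.2 b
  have h1 := (hg.tendsto_at 0).norm
  refine not_tendsto_nhds_of_tendsto_atTop ?_ _ h1
  refine tendsto_atTop_mono (fun m => ?_) tendsto_natCast_atTop_atTop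
  have h2 : (m : ℝ) ≤ (φ m : ℝ) := by exact_mod_cast hφ.id_le m
  simpa using h2.trans (hb (φ m)).le

/-- Mean value inequality for x ↦ f(x) - x f'(t) on [t, t+h]. The error of the difference quotient
is thus uniform in t. -/
theorem norm_sub_sub_smul_deriv_le {f f' : ℝ → ℂ} (hf : ∀ t, HasDerivAt f (f' t) t) {K : ℝ}
    (hK : ∀ s t, ‖f' s - f' t‖ ≤ K * |s - t|) (t : ℝ) {h : ℝ} (hh : 0 ≤ h) :
    ‖f (t + h) - f t - (h : ℂ) * f' t‖ ≤ K * h * h := by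
  have hK0 : 0 ≤ K := by simpa using (norm_nonneg _).trans (hK 1 0)
  have hd (x : ℝ) : HasDerivAt (fun x : ℝ => f x - (x : ℂ) * f' t) (f' x - f' t) x := by
    refine ((hf x).sub ((Complex.ofRealCLM.hasDerivAt (x := x)).mul_const (f' t))).congr_deriv ?_
    simp
  have := (convex_Icc t (t + h)).norm_image_sub_le_of_norm_hasDerivWithin_le (C := K * h)
    (fun x _ => (hd x).hasDerivWithinAt) (fun x hx => (hK x t).trans ?_)
    (Set.left_mem_Icc.2 (by linarith)) (Set.right_mem_Icc.2 (by linarith))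
  · convert! this using 2
    · push_cast; ring
    · rw [Real.norm_eq_abs, add_sub_cancel_left, abs_of_nonneg hh]
  · rw [abs_of_nonneg (by linarith [hx.1])]
    gcongr
    linarith [hx.2]

/-- The derivative of an almost periodic function is almost periodic if it is Lipschitz. -/
theorem deriv_mem_AP {f f' : ℝ → ℂ} (hfAP : f ∈ AP) (hf : ∀ t, HasDerivAt f (f' t) t) {K : ℝ}
    (hK : ∀ s t, ‖f' s - f' t‖ ≤ K * |s - t|) : f' ∈ AP := by
  have hK0 : 0 ≤ K := by simpa using (norm_nonneg _).trans (hK 1 0)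
  refine ⟨(LipschitzWith.of_dist_le_mul (K := K.toNNReal) fun s t => ?_).continuous, fun b => ?_⟩
  · rw [dist_eq_norm, Real.coe_toNNReal K hK0, Real.dist_eq]
    exact hK s t
  obtain ⟨φ, hφ, g, hg⟩ := hfAP.2 b
  -- Difference quotients of fixed step h inherit the uniform Cauchy property from the translates of
  -- f, and they approximate f' uniformly up to Kh.
  have hc : UniformCauchySeqOn (fun m t => f' (t + b (φ m))) atTop Set.univ := by
    rw [Metric.uniformCauchySeqOn_iff]
    intro ε hε
    -- The error budget, multiplied by h, is two Taylor remainders of at most hε/4 and two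
    -- differences of translates below hε/8, in total less than hε.
    set h : ℝ := ε / (4 * (K + 1)) with hh
    have hh0 : 0 < h := by positivity
    have hKh : K * h ≤ ε / 4 := by
      rw [hh, mul_div_assoc', div_le_div_iff₀ (by positivity) (by norm_num)]
      nlinarith
    obtain ⟨N, hN⟩ := Metric.uniformCauchySeqOn_iff.1
      (tendstoUniformlyOn_univ.2 hg).uniformCauchySeqOn (h * ε / 8) (by positivity)
    refine ⟨N, fun m hm n hn t _ => ?_⟩
    have e1 := norm_sub_sub_smul_deriv_le hf hK (t + b (φ m)) hh0.le
    have e2 := norm_sub_sub_smul_deriv_le hf hK (t + b (φ n)) hh0.le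
    have e3 := hN m hm n hn t trivial
    have e4 := hN m hm n hn (t + h) trivial
    rw [dist_eq_norm] at e3 e4 ⊢
    rw [add_right_comm t h, add_right_comm t h] at e4
    have key : h * ‖f' (t + b (φ m)) - f' (t + b (φ n))‖ < h * ε := by
      rw [← abs_of_pos hh0, ← Real.norm_eq_abs h, ← Complex.norm_real, ← norm_mul,
        Complex.norm_real, Real.norm_eq_abs, abs_of_pos hh0]
      set x := t + b (φ m)
      set y := t + b (φ n)
      have : (h : ℂ) * (f' x - f' y) = (f (y + h) - f y - (h : ℂ) * f' y) -
          (f (x + h) - f x - (h : ℂ) * f' x) + (f (x + h) - f (y + h)) - (f x - f y) := by ring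
      rw [this]
      refine ((norm_sub_le _ _).trans (add_le_add_left ((norm_add_le _ _).trans
        (add_le_add_left (norm_sub_le _ _) _)) _)).trans_lt ?_
      nlinarith
    exact lt_of_mul_lt_mul_left key hh0.le
  have hp (t : ℝ) : ∃ x, Tendsto (fun m => f' (t + b (φ m))) atTop (𝓝 x) :=
    cauchySeq_tendsto_of_complete (hc.cauchySeq (Set.mem_univ t))
  choose g' hg' using hp
  exact ⟨φ, hφ, g', tendstoUniformlyOn_univ.1
    (hc.tendstoUniformlyOn_of_tendsto fun t _ => hg' t)⟩

/-- Regularity of almost periodic solutions of the Riccati type integral equation. -/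
theorem SolvesRiccati.regularity {a : Fin 3 → ℂ} {lam lam₁ lam₂ : ℂ} {μ : Fin 3 → ℝ → ℂ} {θ : ℝ → ℂ}
    (h₁ : (lam₁ - lam).re ≠ 0) (h₂ : (lam₂ - lam).re ≠ 0) (h₁₂ : lam₁ - lam ≠ lam₂ - lam)
    (hμ : ∀ i, μ i ∈ BC) (hθ : θ ∈ BC) (hθeq : SolvesRiccati a μ lam lam₁ lam₂ θ)
    {C : ℝ≥0∞} (hC : C ≠ ⊤) (hC₁ : ∀ t, absGreen (lam₁ - lam) (deriv θ) t ≤ C)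
    (hC₂ : ∀ t, absGreen (lam₂ - lam) (deriv θ) t ≤ C) :
    deriv θ ∈ BC ∧ riccatiTerm a μ lam θ ∈ BC ∧ ∃ K : ℝ, ∀ s t, ‖deriv θ s - deriv θ t‖ ≤ K * |s - t| := by
  set f := riccatiTerm a μ lam θ with hf
  have hdθ : Measurable (deriv θ) := measurable_deriv θ
  -- The term is affine in θ' with bounded continuous coefficients, so bounds on the potentials of
  -- θ' carry over to it although θ' may still be unbounded.
  obtain ⟨A, B, hA, hB, hfAB⟩ : ∃ A B : ℝ → ℂ, A ∈ BC ∧ B ∈ BC ∧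
      f = fun t => A t + B t * deriv θ t := by
    refine ⟨fun t => pertPoly μ lam t + (2 * lam * μ 2 t + μ 1 t) * θ t +
      ((a 2 + μ 2 t + 3 * lam) * θ t ^ 2 + θ t ^ 3), fun t => μ 2 t + 3 * θ t, ?_, ?_, ?_⟩
    · exact add_mem_BC (add_mem_BC (add_mem_BC (add_mem_BC (const_mul_mem_BC _ (hμ 2))
        (const_mul_mem_BC _ (hμ 1))) (hμ 0)) (mul_mem_BC (add_mem_BC (const_mul_mem_BC _ (hμ 2))
        (hμ 1)) hθ)) (add_mem_BC (mul_mem_BC (add_mem_BC (add_mem_BC (const_mem_BC _) (hμ 2))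
        (const_mem_BC _)) (pow_mem_BC hθ 2)) (pow_mem_BC hθ 3))
    · exact add_mem_BC (hμ 2) (const_mul_mem_BC _ hθ)
    · ext t
      simp only [hf, riccatiTerm, linTerm, nonlinTerm]
      ring
  obtain ⟨CA, hCA, hA'⟩ := exists_enorm_le_of_mem_BC hA
  obtain ⟨CB, hCB, hB'⟩ := exists_enorm_le_of_mem_BC hB
  have hfm : AEStronglyMeasurable f volume := by
    rw [hfAB]
    exact hA.1.aestronglyMeasurable.add (hB.1.aestronglyMeasurable.mul hdθ.aestronglyMeasurable)
  have hfG (γ : ℂ) (hγ : γ.re ≠ 0) (hγC : ∀ t, absGreen γ (deriv θ) t ≤ C) (t : ℝ) :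
      absGreen γ f t ≤ ENNReal.ofReal (1 / |γ.re|) * CA + CB * C := by
    calc absGreen γ f t ≤ ∫⁻ s, (‖greenKernel γ t s‖ₑ * ‖A s‖ₑ +
          CB * (‖greenKernel γ t s‖ₑ * ‖deriv θ s‖ₑ)) := by
          rw [absGreen_eq]
          refine lintegral_mono fun s => ?_
          rw [hfAB]
          calc _ ≤ ‖greenKernel γ t s‖ₑ * (‖A s‖ₑ + ‖B s‖ₑ * ‖deriv θ s‖ₑ) := by
                gcongr
                rw [← enorm_mul]
                exact enorm_add_le _ _
            _ ≤ ‖greenKernel γ t s‖ₑ * (‖A s‖ₑ + CB * ‖deriv θ s‖ₑ) := by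
                gcongr
                exact hB' s
            _ = _ := by ring
      _ = absGreen γ A t + CB * absGreen γ (deriv θ) t := by
          have hm : Measurable fun s => ‖greenKernel γ t s‖ₑ * ‖A s‖ₑ :=
            (measurable_greenKernel γ t).enorm.mul hA.1.measurable.enorm
          rw [lintegral_add_left hm, lintegral_const_mul' _ _ hCB, absGreen_eq, absGreen_eq]
      _ ≤ _ := by
          gcongr
          · exact absGreen_le_of_bound hγ hA' t
          · exact hγC t
  have hfin (γ : ℂ) : ENNReal.ofReal (1 / |γ.re|) * CA + CB * C ≠ ⊤ := by finiteness
  have hder (t : ℝ) := hasDerivAt_of_eq_neg_green h₁ h₂ h₁₂ hfm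
    (fun t => ne_top_of_le_ne_top (hfin _) (hfG _ h₁ hC₁ t))
    (fun t => ne_top_of_le_ne_top (hfin _) (hfG _ h₂ hC₂ t)) hθeq.1 hθeq.2 t
  have hd : deriv θ = fun t => -greenDeriv (lam₁ - lam) (lam₂ - lam) f t :=
    funext fun t => (hder t).deriv
  have hdBC : deriv θ ∈ BC := by
    rw [hd]
    exact neg_mem_BC (add_mem_BC
      (const_mul_mem_BC _ (scalarGreen_mem_BC h₁ hfm (hfin _) (hfG _ h₁ hC₁)))
      (const_mul_mem_BC _ (scalarGreen_mem_BC h₂ hfm (hfin _) (hfG _ h₂ hC₂))))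
  have hfBC : f ∈ BC := by
    rw [hfAB]
    exact add_mem_BC hA (mul_mem_BC hB hdBC)
  refine ⟨hdBC, hfBC, ?_⟩
  -- With the density now in `BC`, θ' is differentiable and θ'' is bounded, which yields the
  -- Lipschitz bound.
  have h2 (t : ℝ) := (hasDerivAt_greenDeriv h₁ h₂ h₁₂ hfBC t).neg
  obtain ⟨-, K, hK⟩ := neg_mem_BC (add_mem_BC (sub_mem_BC
    (const_mul_mem_BC ((lam₁ - lam) + (lam₂ - lam)) (greenDeriv_mem_BC h₁ h₂ hfBC))
    (const_mul_mem_BC ((lam₁ - lam) * (lam₂ - lam)) (green_mem_BC h₁ h₂ hfBC))) hfBC)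
  refine ⟨K, fun s t => ?_⟩
  rw [hd]
  exact convex_univ.norm_image_sub_le_of_norm_hasDerivWithin_le
    (fun x _ => (h2 x).hasDerivWithinAt) (fun x _ => hK x) (Set.mem_univ t) (Set.mem_univ s)

/-! ## Convolution with a two-sided exponential and a comparison principle -/

/-- `∫ e^{-β|t-s|} h(s) ds`. -/
noncomputable def expConv (β : ℝ) (h : ℝ → ℝ≥0∞) (t : ℝ) : ℝ≥0∞ :=
  ∫⁻ s, ENNReal.ofReal (Real.exp (-(β * |t - s|))) * h s

theorem measurable_expKernel (β : ℝ) :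
    Measurable fun x : ℝ × ℝ => ENNReal.ofReal (Real.exp (-(β * |x.1 - x.2|))) :=
  ENNReal.measurable_ofReal.comp (by fun_prop : Continuous _).measurable

theorem measurable_expKernel_right (β t : ℝ) :
    Measurable fun s : ℝ => ENNReal.ofReal (Real.exp (-(β * |t - s|))) :=
  ENNReal.measurable_ofReal.comp (by fun_prop : Continuous _).measurable

theorem measurable_expConv (β : ℝ) {h : ℝ → ℝ≥0∞} (hh : Measurable h) : Measurable (expConv β h) :=
  ((measurable_expKernel β).mul (hh.comp measurable_snd)).lintegral_prod_right'

theorem expConv_mono {β : ℝ} {h k : ℝ → ℝ≥0∞} (hk : ∀ s, h s ≤ k s) (t : ℝ) :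
    expConv β h t ≤ expConv β k t :=
  lintegral_mono fun s => by gcongr; exact hk s

/-- The kernels of rates β and -β live on opposite sides of t and together form e^{-β|t-s|} off the
null set s = t. -/
theorem expConv_enorm_eq {β : ℝ} (hβ : 0 < β) {f : ℝ → ℂ} (hf : Measurable f) (t : ℝ) :
    expConv β (fun s => ‖f s‖ₑ) t = absGreen (β : ℂ) f t + absGreen (-(β : ℂ)) f t := by
  have h1 : ((β : ℂ)).re ≠ 0 := by simpa using hβ.ne'
  have h2 : (-(β : ℂ)).re ≠ 0 := by simpa using hβ.ne'
  have e : ∀ᵐ s : ℝ, ENNReal.ofReal (Real.exp (-(β * |t - s|))) * ‖f s‖ₑ =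
      ‖greenKernel (β : ℂ) t s‖ₑ * ‖f s‖ₑ + ‖greenKernel (-(β : ℂ)) t s‖ₑ * ‖f s‖ₑ := by
    have : ∀ᵐ s : ℝ, s ≠ t := by simp [ae_iff, measure_singleton]
    filter_upwards [this] with s hs
    rw [← add_mul, enorm_greenKernel h1, enorm_greenKernel h2]
    simp only [Complex.ofReal_re, Complex.neg_re, Real.sign_of_pos hβ,
      Real.sign_of_neg (neg_lt_zero.2 hβ), abs_neg, abs_of_pos hβ, one_mul, neg_one_mul]
    rcases lt_or_gt_of_ne hs with h | h
    · simp [h, h.not_gt]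
    · simp [h, h.not_gt]
  rw [expConv, lintegral_congr_ae e, absGreen_eq, absGreen_eq]
  exact lintegral_add_left ((measurable_greenKernel _ t).enorm.mul hf.enorm) _

theorem lintegral_expKernel {β : ℝ} (hβ : 0 < β) (t : ℝ) :
    ∫⁻ s, ENNReal.ofReal (Real.exp (-(β * |t - s|))) = ENNReal.ofReal (2 / β) := by
  have h1 : ((β : ℂ)).re ≠ 0 := by simpa using hβ.ne'
  have h2 : (-(β : ℂ)).re ≠ 0 := by simpa using hβ.ne'
  have h := expConv_enorm_eq hβ (f := fun _ => (1 : ℂ)) measurable_const t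
  simp only [expConv, absGreen_eq, enorm_one, mul_one, lintegral_enorm_greenKernel h1,
    lintegral_enorm_greenKernel h2] at h
  rw [h, ← ENNReal.ofReal_add (by positivity) (by positivity)]
  simp only [Complex.ofReal_re, Complex.neg_re, abs_neg, abs_of_pos hβ]
  congr 1; ring

theorem expConv_le_of_bound {β : ℝ} (hβ : 0 < β) {h : ℝ → ℝ≥0∞} {C : ℝ≥0∞} (hh : ∀ s, h s ≤ C)
    (t : ℝ) : expConv β h t ≤ ENNReal.ofReal (2 / β) * C := by
  rw [← lintegral_expKernel hβ t, ← lintegral_mul_const _ (measurable_expKernel_right β t)]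
  exact lintegral_mono fun s => by gcongr; exact hh s

/-- Triangle inequality |t-r| ≤ |t-s| + |s-r| in the exponent: a Harnack type bound on the variation
of the convolution. -/
theorem expConv_le_exp_mul {β : ℝ} (hβ : 0 ≤ β) (h : ℝ → ℝ≥0∞) (t s : ℝ) :
    expConv β h s ≤ ENNReal.ofReal (Real.exp (β * |t - s|)) * expConv β h t := by
  unfold expConv
  rw [← lintegral_const_mul' _ _ ENNReal.ofReal_ne_top]
  refine lintegral_mono fun r => ?_
  simp only
  rw [← mul_assoc, ← ENNReal.ofReal_mul (by positivity), ← Real.exp_add]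
  gcongr
  nlinarith [abs_sub_le t s r]

/-- The convolution is moved from s to t at the cost of e^{β|t-s|}, and the kernel absorbs that
factor. This lets a twisted contraction act on multiples of the convolution. -/
theorem majorant_expConv_le {γ₁ γ₂ : ℂ} (h₁ : γ₁.re ≠ 0) (h₂ : γ₂.re ≠ 0) {β : ℝ} (hβ : 0 ≤ β)
    (hβ₁ : β < |γ₁.re|) (hβ₂ : β < |γ₂.re|) {W : ℝ → ℝ≥0∞} (hW : Measurable W) (h : ℝ → ℝ≥0∞) (t : ℝ) :
    majorant γ₁ γ₂ 0 (fun s => W s * expConv β h s) t ≤ majorant γ₁ γ₂ β W t * expConv β h t := by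
  have key (γ : ℂ) (hγ : γ.re ≠ 0) (hβγ : β < |γ.re|) :
      ∫⁻ s, twistedKernel 0 γ t s * (W s * expConv β h s) ≤
        (∫⁻ s, twistedKernel β γ t s * W s) * expConv β h t := by
    have hm : Measurable fun s => twistedKernel β γ t s * W s := (measurable_twistedKernel β γ t).mul hW
    rw [← lintegral_mul_const _ hm]
    refine lintegral_mono fun s => ?_
    simp only
    rw [← twistedKernel_mul_exp hγ hβγ]
    calc _ ≤ twistedKernel 0 γ t s * (W s *
          (ENNReal.ofReal (Real.exp (β * |t - s|)) * expConv β h t)) := by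
          gcongr; exact expConv_le_exp_mul hβ h t s
      _ = _ := by ring
  unfold majorant
  rw [add_mul, mul_assoc, mul_assoc]
  gcongr
  · exact key _ h₁ hβ₁
  · exact key _ h₂ hβ₂

theorem majorant_zero_le {γ₁ γ₂ : ℂ} (h₁ : γ₁.re ≠ 0) (h₂ : γ₂.re ≠ 0) {β : ℝ} (hβ : 0 ≤ β)
    (hβ₁ : β < |γ₁.re|) (hβ₂ : β < |γ₂.re|) (W : ℝ → ℝ≥0∞) (t : ℝ) :
    majorant γ₁ γ₂ 0 W t ≤ majorant γ₁ γ₂ β W t := by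
  have key (γ : ℂ) (hγ : γ.re ≠ 0) (hβγ : β < |γ.re|) (s : ℝ) :
      twistedKernel 0 γ t s ≤ twistedKernel β γ t s := by
    rw [← twistedKernel_mul_exp hγ hβγ]
    refine le_mul_of_one_le_right' (ENNReal.one_le_ofReal.2 (Real.one_le_exp (by positivity)))
  unfold majorant
  gcongr
  · exact key _ h₁ hβ₁ _
  · exact key _ h₂ hβ₂ _

theorem majorant_zero_le_expConv {γ₁ γ₂ : ℂ} (h₁ : γ₁.re ≠ 0) (h₂ : γ₂.re ≠ 0) {β : ℝ}
    (hβ₁ : β < |γ₁.re|) (hβ₂ : β < |γ₂.re|) (h : ℝ → ℝ≥0∞) (t : ℝ) :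
    majorant γ₁ γ₂ 0 h t ≤ (weight γ₁ γ₂ γ₁ + weight γ₁ γ₂ γ₂) * expConv β h t := by
  unfold majorant expConv
  rw [add_mul]
  gcongr
  · exact twistedKernel_zero_le h₁ hβ₁.le _ _
  · exact twistedKernel_zero_le h₂ hβ₂.le _ _

/-- Comparison principle: subsolutions of `m = C E + K m`, with a positive contraction `K`, are
dominated by a multiple of the exponential convolution `E`. -/
theorem le_expConv_of_le_majorant {γ₁ γ₂ : ℂ} (h₁ : γ₁.re ≠ 0) (h₂ : γ₂.re ≠ 0) {β : ℝ} (hβ : 0 ≤ β)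
    (hβ₁ : β < |γ₁.re|) (hβ₂ : β < |γ₂.re|) {W m h : ℝ → ℝ≥0∞} (hW : Measurable W)
    (hh : Measurable h) {q B C : ℝ≥0∞} (hq : q < 1) (hWq : ∀ t, majorant γ₁ γ₂ β W t ≤ q)
    (hB : B ≠ ⊤) (hmB : ∀ t, m t ≤ B) (hC : C ≠ ⊤)
    (hm : ∀ t, m t ≤ C * expConv β h t + majorant γ₁ γ₂ 0 (fun s => W s * m s) t) (t : ℝ) :
    m t ≤ C * (1 - q)⁻¹ * expConv β h t := by
  set c := C * (1 - q)⁻¹ with hc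
  have hq0 : 1 - q ≠ 0 := (tsub_pos_of_lt hq).ne'
  have hqt : 1 - q ≠ ⊤ := ne_top_of_le_ne_top ENNReal.one_ne_top tsub_le_self
  have hct : c ≠ ⊤ := ENNReal.mul_ne_top hC (ENNReal.inv_ne_top.2 hq0)
  -- The constant c = C/(1-q) is the fixed point of c ↦ C + qc, so the iteration below reproduces
  -- it.
  have hcc : C + q * c = c := by
    have : C = (1 - q) * c := by
      rw [hc, mul_left_comm, ENNReal.mul_inv_cancel hq0 hqt, mul_one]
    conv_lhs => rw [this, ← add_mul, tsub_add_cancel_of_le hq.le, one_mul]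
  -- Inserting the bound into the inequality multiplies the crude part B by q each time and leaves
  -- the part c E unchanged.
  have key (n : ℕ) : ∀ t, m t ≤ c * expConv β h t + q ^ n * B := by
    induction n with
    | zero => exact fun t => (hmB t).trans (by simp)
    | succ n ih =>
      intro t
      calc m t ≤ C * expConv β h t + majorant γ₁ γ₂ 0 (fun s => W s * m s) t := hm t
        _ ≤ C * expConv β h t + majorant γ₁ γ₂ 0
            (fun s => c * (W s * expConv β h s) + q ^ n * B * W s) t := by
            gcongr
            refine majorant_mono (fun s => ?_) t
            calc W s * m s ≤ W s * (c * expConv β h s + q ^ n * B) := by gcongr; exact ih s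
              _ = _ := by ring
        _ = C * expConv β h t + (c * majorant γ₁ γ₂ 0 (fun s => W s * expConv β h s) t +
            q ^ n * B * majorant γ₁ γ₂ 0 W t) := by
            have hmeas : Measurable fun s => c * (W s * expConv β h s) :=
              measurable_const.mul (hW.mul (measurable_expConv β hh))
            rw [majorant_add hmeas,
              majorant_const_mul hct, majorant_const_mul]
            exact ENNReal.mul_ne_top (ENNReal.pow_ne_top hq.ne_top) hB
        _ ≤ C * expConv β h t + (c * (q * expConv β h t) + q ^ n * B * q) := by
            gcongr
            · refine (majorant_expConv_le h₁ h₂ hβ hβ₁ hβ₂ hW h t).trans ?_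
              gcongr
              exact hWq t
            · exact (majorant_zero_le h₁ h₂ hβ hβ₁ hβ₂ W t).trans (hWq t)
        _ = (C + q * c) * expConv β h t + q ^ (n + 1) * B := by ring
        _ = _ := by rw [hcc]
  have hlim : Tendsto (fun n : ℕ => c * expConv β h t + q ^ n * B) atTop
      (𝓝 (c * expConv β h t + 0 * B)) :=
    tendsto_const_nhds.add (ENNReal.Tendsto.mul_const
      (ENNReal.tendsto_pow_atTop_nhds_zero_of_lt_one hq) (Or.inr hB))
  rw [zero_mul, add_zero] at hlim
  exact ge_of_tendsto' hlim fun n => key n t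

/-- A strict contraction bound persists for small exponential twists. -/
theorem exists_twist_majorant_lt_one {γ₁ γ₂ : ℂ} (h₁ : γ₁.re ≠ 0) (h₂ : γ₂.re ≠ 0)
    {W : ℝ → ℝ≥0∞} (hW : Measurable W) {C q : ℝ≥0∞} (hC : C ≠ ⊤) (hWC : ∀ s, W s ≤ C) (hq : q < 1)
    (hWq : ∀ t, majorant γ₁ γ₂ 0 W t ≤ q) :
    ∃ β : ℝ, 0 < β ∧ β < |γ₁.re| ∧ β < |γ₂.re| ∧ ∃ q' : ℝ≥0∞, q' < 1 ∧
      ∀ t, majorant γ₁ γ₂ β W t ≤ q' := by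
  obtain ⟨δ, hδ, hδm⟩ := exists_between (lt_min (abs_pos.2 h₁) (abs_pos.2 h₂))
  obtain ⟨hδ₁, hδ₂⟩ := lt_min_iff.1 hδm
  obtain ⟨D, hD, hWD⟩ := majorant_ne_top h₁ h₂ hδ₁ hδ₂ hC hWC
  have hlim : Tendsto (fun τ : ℝ => q + ENNReal.ofReal τ * D) (𝓝[>] 0) (𝓝 (q + 0 * D)) := by
    refine tendsto_const_nhds.add (ENNReal.Tendsto.mul_const ?_ (Or.inr hD))
    rw [← ENNReal.ofReal_zero]
    exact (ENNReal.continuous_ofReal.tendsto 0).mono_left nhdsWithin_le_nhds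
  rw [zero_mul, add_zero] at hlim
  -- By convexity, twisting by τδ costs at most τD, which fits into the gap 1 - q for small τ.
  obtain ⟨τ, hτ, hτ0, hτ1⟩ := ((hlim.eventually_lt_const hq).and
    (Ioo_mem_nhdsGT (zero_lt_one' ℝ))).exists
  have hτδ : τ * δ ≤ δ := mul_le_of_le_one_left hδ.le hτ1.le
  refine ⟨τ * δ, by positivity, hτδ.trans_lt hδ₁, hτδ.trans_lt hδ₂, _, hτ, fun t => ?_⟩
  have key (γ : ℂ) (hγ : γ.re ≠ 0) (hδγ : δ < |γ.re|) :
      ∫⁻ s, twistedKernel (τ * δ) γ t s * W s ≤ (∫⁻ s, twistedKernel 0 γ t s * W s) +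
        ENNReal.ofReal τ * ∫⁻ s, twistedKernel δ γ t s * W s := by
    have hm : Measurable fun s => twistedKernel 0 γ t s * W s := (measurable_twistedKernel 0 γ t).mul hW
    rw [← lintegral_const_mul' _ _ ENNReal.ofReal_ne_top, ← lintegral_add_left hm]
    refine lintegral_mono fun s => ?_
    simp only
    rw [← mul_assoc, ← add_mul]
    gcongr
    exact twistedKernel_convex hγ hδ.le hδγ hτ0.le hτ1.le t s
  calc majorant γ₁ γ₂ (τ * δ) W t
      ≤ majorant γ₁ γ₂ 0 W t + ENNReal.ofReal τ * majorant γ₁ γ₂ δ W t := by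
        unfold majorant
        calc _ ≤ _ := add_le_add (mul_le_mul_right (key γ₁ h₁ hδ₁) (weight γ₁ γ₂ γ₁))
              (mul_le_mul_right (key γ₂ h₂ hδ₂) (weight γ₁ γ₂ γ₂))
          _ = _ := by ring
    _ ≤ _ := by gcongr; exacts [hWq t, hWD t]

/-- Up to a small constant, exponential convolutions with different rates are comparable. -/
theorem exists_expConv_le_add {β δ : ℝ} (hβ : 0 ≤ β) (hδ : 0 < δ) {h : ℝ → ℝ≥0∞}
    (hh : Measurable h) {C : ℝ≥0∞} (hC : C ≠ ⊤) (hhC : ∀ s, h s ≤ C) {η : ℝ≥0∞} (hη : 0 < η) :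
    ∃ A : ℝ≥0∞, A ≠ ⊤ ∧ ∀ t, expConv δ h t ≤ A * expConv β h t + η := by
  -- The integral is split at |t-s| = T. Inside, the kernel of rate δ is at most e^{βT}e^{-β|t-s|};
  -- outside, half of the rate δ supplies the factor e^{-δT/2} and the other half keeps the integral
  -- bounded.
  have hlim : Tendsto (fun T : ℝ => ENNReal.ofReal (Real.exp (-(δ / 2 * T))) *
      (ENNReal.ofReal (2 / (δ / 2)) * C)) atTop (𝓝 (ENNReal.ofReal 0 *
        (ENNReal.ofReal (2 / (δ / 2)) * C))) := by
    refine ENNReal.Tendsto.mul_const ?_ (Or.inr (ENNReal.mul_ne_top ENNReal.ofReal_ne_top hC))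
    refine ENNReal.tendsto_ofReal (Real.tendsto_exp_neg_atTop_nhds_zero.comp ?_)
    exact tendsto_id.const_mul_atTop (by positivity)
  rw [ENNReal.ofReal_zero, zero_mul] at hlim
  obtain ⟨T, hT⟩ := (hlim.eventually_lt_const hη).exists
  refine ⟨ENNReal.ofReal (Real.exp (β * T)), ENNReal.ofReal_ne_top, fun t => ?_⟩
  calc expConv δ h t ≤ ENNReal.ofReal (Real.exp (β * T)) * expConv β h t +
        ENNReal.ofReal (Real.exp (-(δ / 2 * T))) * expConv (δ / 2) h t := by
        unfold expConv
        have hm : Measurable fun s => ENNReal.ofReal (Real.exp (β * T)) *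
            (ENNReal.ofReal (Real.exp (-(β * |t - s|))) * h s) :=
          measurable_const.mul ((measurable_expKernel_right β t).mul hh)
        rw [← lintegral_const_mul' _ _ ENNReal.ofReal_ne_top,
          ← lintegral_const_mul' _ _ ENNReal.ofReal_ne_top, ← lintegral_add_left hm]
        refine lintegral_mono fun s => ?_
        simp only
        rw [← mul_assoc, ← mul_assoc, ← ENNReal.ofReal_mul (by positivity),
          ← ENNReal.ofReal_mul (by positivity), ← Real.exp_add, ← Real.exp_add, ← add_mul]
        gcongr
        rcases le_total |t - s| T with hs | hs
        · refine le_add_right (ENNReal.ofReal_le_ofReal (Real.exp_le_exp.2 ?_))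
          nlinarith [abs_nonneg (t - s)]
        · refine le_add_left (ENNReal.ofReal_le_ofReal (Real.exp_le_exp.2 ?_))
          nlinarith
    _ ≤ _ := by
        gcongr
        refine le_trans ?_ hT.le
        gcongr
        exact expConv_le_of_bound (by positivity) hhC t

/-! ## Decay of exponential convolutions -/

theorem expConv_eq_lintegral_sub (β : ℝ) {h : ℝ → ℝ≥0∞} (t : ℝ) :
    expConv β h t = ∫⁻ u, ENNReal.ofReal (Real.exp (-(β * |u|))) * h (t - u) := by
  rw [← lintegral_sub_left_eq_self _ t, expConv]
  simp

/-- Dominated convergence after moving the translation onto h. Only translation invariance of the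
filter is used, so one proof serves both ends of the line. -/
theorem tendsto_expConv {β : ℝ} (hβ : 0 < β) {h : ℝ → ℝ≥0∞} (hh : Measurable h) {C : ℝ≥0∞}
    (hC : C ≠ ⊤) (hhC : ∀ s, h s ≤ C) {l : Filter ℝ} [l.IsCountablyGenerated]
    (hl : ∀ u : ℝ, Tendsto (fun t => t - u) l l) (hhl : Tendsto h l (𝓝 0)) :
    Tendsto (expConv β h) l (𝓝 0) := by
  have hk : Measurable fun u : ℝ => ENNReal.ofReal (Real.exp (-(β * |u|))) :=
    ENNReal.measurable_ofReal.comp (by fun_prop : Continuous _).measurable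
  have := tendsto_lintegral_filter_of_dominated_convergence (μ := volume) (l := l)
    (F := fun t u => ENNReal.ofReal (Real.exp (-(β * |u|))) * h (t - u)) (f := fun _ => 0)
    (fun u => ENNReal.ofReal (Real.exp (-(β * |u|))) * C)
    (Eventually.of_forall fun t => hk.mul (hh.comp (measurable_const.sub measurable_id)))
    (Eventually.of_forall fun t => ae_of_all _ fun u => by gcongr; exact hhC _) ?_
    (ae_of_all _ fun u => ?_)
  · rw [lintegral_zero] at this
    exact this.congr fun t => (expConv_eq_lintegral_sub β t).symm
  · rw [lintegral_mul_const _ hk]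
    have h0 := lintegral_expKernel hβ 0
    simp only [zero_sub, abs_neg] at h0
    rw [h0]
    exact ENNReal.mul_ne_top ENNReal.ofReal_ne_top hC
  · simpa using ENNReal.Tendsto.const_mul (hhl.comp (hl u)) (Or.inr ENNReal.ofReal_ne_top)

/-- Jensen's inequality for exponential convolutions. -/
theorem expConv_rpow_le {β : ℝ} (hβ : 0 < β) {p : ℝ} (hp : 1 ≤ p) {κ : ℝ → ℝ} (hκ : Measurable κ)
    (t : ℝ) : expConv β (fun s => ‖κ s‖ₑ) t ^ p ≤
      ENNReal.ofReal (2 / β) ^ (p - 1) * expConv β (fun s => ‖κ s‖ₑ ^ p) t := by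
  have hk := measurable_expKernel_right β t
  -- The kernel is made into a measure of mass 2/β, on which the L¹ and Lᵖ norms are compared.
  set ρ : Measure ℝ := volume.withDensity fun s => ENNReal.ofReal (Real.exp (-(β * |t - s|))) with hρ
  have hint {g : ℝ → ℝ≥0∞} (hg : Measurable g) : ∫⁻ s, g s ∂ρ = expConv β g t := by
    rw [hρ, lintegral_withDensity_eq_lintegral_mul _ hk hg]; rfl
  have hu : ρ Set.univ = ENNReal.ofReal (2 / β) := by
    rw [hρ, withDensity_apply _ MeasurableSet.univ, Measure.restrict_univ, lintegral_expKernel hβ]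
  have h := eLpNorm'_le_eLpNorm'_mul_rpow_measure_univ (μ := ρ) one_pos hp hκ.aestronglyMeasurable
  rw [eLpNorm', eLpNorm', hu] at h
  simp only [ENNReal.rpow_one, div_one] at h
  rw [hint hκ.enorm, hint (hκ.enorm.pow_const p)] at h
  have hp0 : 0 < p := by linarith
  calc _ ≤ _ := ENNReal.rpow_le_rpow h hp0.le
    _ = _ := by
      rw [ENNReal.mul_rpow_of_nonneg _ _ hp0.le, ← ENNReal.rpow_mul, ← ENNReal.rpow_mul,
        one_div_mul_cancel hp0.ne', ENNReal.rpow_one, mul_comm, sub_mul, one_mul,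
        one_div_mul_cancel hp0.ne']

theorem lintegral_expConv {β : ℝ} (hβ : 0 < β) {h : ℝ → ℝ≥0∞} (hh : Measurable h) :
    ∫⁻ t, expConv β h t = ENNReal.ofReal (2 / β) * ∫⁻ s, h s := by
  unfold expConv
  rw [lintegral_lintegral_swap
    ((measurable_expKernel β).mul (hh.comp measurable_snd)).aemeasurable]
  rw [← lintegral_const_mul _ hh]
  refine lintegral_congr fun s => ?_
  rw [lintegral_mul_const]
  · simp_rw [abs_sub_comm _ s]
    rw [lintegral_expKernel hβ s]
  · simp_rw [abs_sub_comm _ s]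
    exact measurable_expKernel_right β s

/-- Young's inequality for the exponential kernel: Jensen pointwise, then Tonelli. The domination is
required only on S, so that [0,∞) can be treated alone. -/
theorem memLp_of_le_expConv {β : ℝ} (hβ : 0 < β) {p : ℝ} (hp : 1 ≤ p) {κ : ℝ → ℝ}
    (hκ : Measurable κ) (hκp : MemLp κ (ENNReal.ofReal p) volume) {f : ℝ → ℂ}
    (hf : AEStronglyMeasurable f volume) {C : ℝ≥0∞} (hC : C ≠ ⊤) {S : Set ℝ} (hS : MeasurableSet S)
    (hfκ : ∀ t ∈ S, ‖f t‖ₑ ≤ C * expConv β (fun s => ‖κ s‖ₑ) t) :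
    MemLp f (ENNReal.ofReal p) (volume.restrict S) := by
  have hp0 : 0 < p := by linarith
  have e0 : ENNReal.ofReal p ≠ 0 := by simpa using hp0
  refine ⟨hf.restrict, ?_⟩
  rw [eLpNorm_lt_top_iff_lintegral_rpow_enorm_lt_top e0 ENNReal.ofReal_ne_top,
    ENNReal.toReal_ofReal hp0.le]
  have h1 := (eLpNorm_lt_top_iff_lintegral_rpow_enorm_lt_top e0 ENNReal.ofReal_ne_top).1 hκp.2
  rw [ENNReal.toReal_ofReal hp0.le] at h1
  calc ∫⁻ t in S, ‖f t‖ₑ ^ p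
      ≤ ∫⁻ t in S, C ^ p * ENNReal.ofReal (2 / β) ^ (p - 1) * expConv β (fun s => ‖κ s‖ₑ ^ p) t := by
        refine setLIntegral_mono' hS fun t ht => ?_
        refine (ENNReal.rpow_le_rpow (hfκ t ht) hp0.le).trans ?_
        rw [ENNReal.mul_rpow_of_nonneg _ _ hp0.le, mul_assoc]
        gcongr
        exact expConv_rpow_le hβ hp hκ t
    _ ≤ ∫⁻ t, C ^ p * ENNReal.ofReal (2 / β) ^ (p - 1) * expConv β (fun s => ‖κ s‖ₑ ^ p) t :=
        setLIntegral_le_lintegral _ _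
    _ = C ^ p * ENNReal.ofReal (2 / β) ^ (p - 1) * (ENNReal.ofReal (2 / β) * ∫⁻ s, ‖κ s‖ₑ ^ p) := by
        rw [lintegral_const_mul _ (measurable_expConv β (hκ.enorm.pow_const p)),
          lintegral_expConv hβ (hκ.enorm.pow_const p)]
    _ < ⊤ := by
        have := ENNReal.rpow_ne_top_of_nonneg hp0.le hC
        have := ENNReal.rpow_ne_top_of_nonneg (sub_nonneg.2 hp) (ENNReal.ofReal_ne_top (r := 2 / β))
        have := h1.ne
        finiteness

/-- On `[0,∞)` the influence of the left half line is dominated by that of `[0,1]`. -/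
theorem expConv_indicator_Iio_le {β : ℝ} (hβ : 0 < β) {t : ℝ} (ht : 0 ≤ t) :
    expConv β ((Set.Iio 0).indicator 1) t ≤ ENNReal.ofReal (2 / β) * ENNReal.ofReal (Real.exp β) *
      expConv β ((Set.Icc 0 1).indicator 1) t := by
  -- For s < 0 ≤ t the kernel factors as e^{-βt}e^{-β|s|}.
  have h1 : expConv β ((Set.Iio 0).indicator 1) t ≤
      ENNReal.ofReal (Real.exp (-(β * t))) * ENNReal.ofReal (2 / β) := by
    rw [← lintegral_expKernel hβ 0, ← lintegral_const_mul' _ _ ENNReal.ofReal_ne_top]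
    refine lintegral_mono fun s => ?_
    simp only
    by_cases hs : s ∈ Set.Iio (0 : ℝ)
    · have hs' : s < 0 := hs
      rw [Set.indicator_of_mem hs, Pi.one_apply, mul_one, ← ENNReal.ofReal_mul (by positivity),
        ← Real.exp_add, abs_of_pos (by linarith), abs_of_pos (by linarith)]
      gcongr
      linarith
    · rw [Set.indicator_of_notMem hs]
      simp
  -- On [0,1] one has |t-s| ≤ t + 1, so the convolution of its indicator is at least e^{-β}e^{-βt}.
  have h2 : ENNReal.ofReal (Real.exp (-(β * t))) ≤ ENNReal.ofReal (Real.exp β) *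
      expConv β ((Set.Icc 0 1).indicator 1) t := by
    calc ENNReal.ofReal (Real.exp (-(β * t)))
        = ∫⁻ s, (Set.Icc (0 : ℝ) 1).indicator (fun _ => ENNReal.ofReal (Real.exp (-(β * t)))) s := by
          rw [lintegral_indicator measurableSet_Icc]; simp
      _ ≤ _ := by
          rw [expConv, ← lintegral_const_mul' _ _ ENNReal.ofReal_ne_top]
          refine lintegral_mono fun s => ?_
          simp only
          by_cases hs : s ∈ Set.Icc (0 : ℝ) 1
          · rw [Set.indicator_of_mem hs, Set.indicator_of_mem hs, ← mul_assoc,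
              ← ENNReal.ofReal_mul (by positivity), ← Real.exp_add]
            simp only [Pi.one_apply, mul_one]
            gcongr
            have : |t - s| ≤ t + 1 := abs_le.2 ⟨by linarith [hs.2], by linarith [hs.1]⟩
            nlinarith
          · rw [Set.indicator_of_notMem hs]
            simp
  calc _ ≤ _ := h1
    _ ≤ _ := mul_le_mul_left h2 _
    _ = _ := by ring

theorem tendsto_zero_of_enorm_le_expConv {β : ℝ} (hβ : 0 < β) {f g : ℝ → ℂ} (hg : g ∈ BC) {C : ℝ≥0∞}
    (hC : C ≠ ⊤) (hfg : ∀ t, ‖f t‖ₑ ≤ C * expConv β (fun s => ‖g s‖ₑ) t) {l : Filter ℝ}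
    [l.IsCountablyGenerated] (hl : ∀ u : ℝ, Tendsto (fun t => t - u) l l)
    (hgl : Tendsto g l (𝓝 0)) : Tendsto f l (𝓝 0) := by
  obtain ⟨D, hD, hgD⟩ := exists_enorm_le_of_mem_BC hg
  have h := tendsto_expConv hβ hg.1.measurable.enorm hD hgD hl
    (by simpa using hgl.enorm)
  have h2 := ENNReal.Tendsto.const_mul h (Or.inr hC)
  rw [mul_zero] at h2
  rw [tendsto_zero_iff_enorm_tendsto_zero]
  exact tendsto_of_tendsto_of_tendsto_of_le_of_le tendsto_const_nhds h2 (fun _ => zero_le) hfg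

/-- Functions dominated by exponential convolutions of decaying functions are decaying. -/
theorem mem_decaying_of_le_expConv {p : ℝ} (hp : 1 ≤ p) (c : Setting) {β : ℝ} (hβ : 0 < β)
    {f g : ℝ → ℂ} (hf : f ∈ BC) (hg : g ∈ BC) (hgc : g ∈ c.decaying p) {C : ℝ≥0∞} (hC : C ≠ ⊤)
    (hfg : ∀ t, ‖f t‖ₑ ≤ C * expConv β (fun s => ‖g s‖ₑ) t) : f ∈ c.decaying p := by
  have htop (u : ℝ) : Tendsto (fun t : ℝ => t - u) atTop atTop :=
    tendsto_atTop_add_const_right _ _ tendsto_id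
  have hbot (u : ℝ) : Tendsto (fun t : ℝ => t - u) atBot atBot :=
    tendsto_atBot_add_const_right _ _ tendsto_id
  cases c with
  | bc0 => exact ⟨hf, tendsto_zero_of_enorm_le_expConv hβ hg hC hfg htop hgc.2⟩
  | c00 =>
    exact ⟨⟨hf, tendsto_zero_of_enorm_le_expConv hβ hg hC hfg htop hgc.1.2⟩,
      tendsto_zero_of_enorm_le_expConv hβ hg hC hfg hbot hgc.2⟩
  | lp =>
    have h := memLp_of_le_expConv hβ hp (κ := fun s => ‖g s‖) hg.1.norm.measurable
      (MemLp.norm hgc) hf.1.aestronglyMeasurable hC MeasurableSet.univ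
      (fun t _ => by simpa using hfg t)
    rwa [Measure.restrict_univ] at h
  | lp0 =>
    obtain ⟨B, hB⟩ := hf.2
    refine ⟨hf.1.aestronglyMeasurable, ⟨B, fun t _ => hB t⟩, ?_⟩
    obtain ⟨D, hD⟩ := hg.2
    have hD0 : 0 ≤ D := (norm_nonneg _).trans (hD 0)
    -- On the left, g is merely bounded by D. Seen from t ≥ 0, that part is replaced by a multiple
    -- of the indicator of [0,1], with the constant of `expConv_indicator_Iio_le`, so that κ₁ + κ₂
    -- is p-integrable on the whole line.
    set κ₁ : ℝ → ℝ := (Set.Ici 0).indicator fun s => ‖g s‖ with hκ₁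
    set κ₂ : ℝ → ℝ := (Set.Icc 0 1).indicator fun _ => D * (2 / β * Real.exp β) with hκ₂
    have hm₁ : Measurable κ₁ := hg.1.norm.measurable.indicator measurableSet_Ici
    have hm₂ : Measurable κ₂ := measurable_const.indicator measurableSet_Icc
    have h0₁ (s : ℝ) : 0 ≤ κ₁ s := Set.indicator_nonneg (fun _ _ => norm_nonneg _) s
    have h0₂ (s : ℝ) : 0 ≤ κ₂ s := Set.indicator_nonneg (fun _ _ => by positivity) s
    have hp₁ : MemLp κ₁ (ENNReal.ofReal p) volume :=
      (memLp_indicator_iff_restrict measurableSet_Ici).2 (MemLp.norm hgc.2.2)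
    have hp₂ : MemLp κ₂ (ENNReal.ofReal p) volume :=
      memLp_indicator_const _ measurableSet_Icc _ (Or.inr (by simp))
    refine memLp_of_le_expConv hβ hp (hm₁.add hm₂) (hp₁.add hp₂) hf.1.aestronglyMeasurable hC
      measurableSet_Ici fun t ht => (hfg t).trans ?_
    gcongr
    have hsplit (s : ℝ) : ‖g s‖ₑ ≤ ‖κ₁ s‖ₑ + ENNReal.ofReal D * (Set.Iio 0).indicator 1 s := by
      by_cases hs : s ∈ Set.Iio (0 : ℝ)
      · rw [Set.indicator_of_mem hs, Pi.one_apply, mul_one, ← ofReal_norm]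
        exact le_add_left (ENNReal.ofReal_le_ofReal (hD s))
      · rw [hκ₁, Set.indicator_of_mem (by simpa using hs), enorm_norm]
        exact le_add_right le_rfl
    have hadd (u v : ℝ → ℝ≥0∞) (hu : Measurable u) :
        expConv β (fun s => u s + v s) t = expConv β u t + expConv β v t := by
      have : Measurable fun s => ENNReal.ofReal (Real.exp (-(β * |t - s|))) * u s :=
        (measurable_expKernel_right β t).mul hu
      unfold expConv
      rw [← lintegral_add_left this]
      simp_rw [mul_add]
    have hcm (a : ℝ≥0∞) (ha : a ≠ ⊤) (u : ℝ → ℝ≥0∞) :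
        expConv β (fun s => a * u s) t = a * expConv β u t := by
      unfold expConv
      rw [← lintegral_const_mul' _ _ ha]
      simp_rw [mul_left_comm a]
    have e₂ (s : ℝ) : ‖κ₂ s‖ₑ = ENNReal.ofReal (D * (2 / β * Real.exp β)) *
        (Set.Icc 0 1).indicator 1 s := by
      by_cases hs : s ∈ Set.Icc (0 : ℝ) 1
      · rw [hκ₂, Set.indicator_of_mem hs, Set.indicator_of_mem hs, Pi.one_apply, mul_one,
          Real.enorm_of_nonneg (by positivity)]
      · rw [hκ₂, Set.indicator_of_notMem hs, Set.indicator_of_notMem hs]; simp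
    calc expConv β (fun s => ‖g s‖ₑ) t
        ≤ expConv β (fun s => ‖κ₁ s‖ₑ + ENNReal.ofReal D * (Set.Iio 0).indicator 1 s) t :=
          expConv_mono hsplit t
      _ = expConv β (fun s => ‖κ₁ s‖ₑ) t + ENNReal.ofReal D * expConv β ((Set.Iio 0).indicator 1) t := by
          rw [hadd _ _ hm₁.enorm, hcm _ ENNReal.ofReal_ne_top]
      _ ≤ expConv β (fun s => ‖κ₁ s‖ₑ) t + ENNReal.ofReal D * (ENNReal.ofReal (2 / β) *
          ENNReal.ofReal (Real.exp β) * expConv β ((Set.Icc 0 1).indicator 1) t) := by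
          gcongr
          exact expConv_indicator_Iio_le hβ ht
      _ = expConv β (fun s => ‖κ₁ s‖ₑ) t + expConv β (fun s => ‖κ₂ s‖ₑ) t := by
          simp_rw [e₂]
          rw [hcm _ ENNReal.ofReal_ne_top, ENNReal.ofReal_mul hD0, ENNReal.ofReal_mul (by positivity)]
          ring
      _ = expConv β (fun s => ‖(κ₁ + κ₂) s‖ₑ) t := by
          rw [← hadd _ _ hm₁.enorm]
          congr 1; ext s
          rw [Pi.add_apply, Real.enorm_of_nonneg (h0₁ s), Real.enorm_of_nonneg (h0₂ s),
            Real.enorm_of_nonneg (add_nonneg (h0₁ s) (h0₂ s)), ENNReal.ofReal_add (h0₁ s) (h0₂ s)]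

theorem add_mem_decaying {p : ℝ} (c : Setting) {f g : ℝ → ℂ} (hf : f ∈ c.decaying p)
    (hg : g ∈ c.decaying p) : (fun t => f t + g t) ∈ c.decaying p := by
  cases c with
  | bc0 => exact ⟨add_mem_BC hf.1 hg.1, by simpa using hf.2.add hg.2⟩
  | c00 =>
    exact ⟨⟨add_mem_BC hf.1.1 hg.1.1, by simpa using hf.1.2.add hg.1.2⟩, by simpa using hf.2.add hg.2⟩
  | lp => exact MemLp.add hf hg
  | lp0 =>
    obtain ⟨hf1, ⟨C, hC⟩, hf2⟩ := hf
    obtain ⟨hg1, ⟨D, hD⟩, hg2⟩ := hg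
    exact ⟨hf1.add hg1, ⟨C + D, fun t ht => (norm_add_le _ _).trans (add_le_add (hC t ht) (hD t ht))⟩,
      hf2.add hg2⟩

theorem mul_mem_decaying {p : ℝ} (c : Setting) {f g : ℝ → ℂ} (hf : f ∈ BC)
    (hg : g ∈ c.decaying p) : (fun t => f t * g t) ∈ c.decaying p := by
  obtain ⟨hfc, C, hC⟩ := hf
  have hC0 : 0 ≤ C := (norm_nonneg _).trans (hC 0)
  have hle (t : ℝ) : ‖f t * g t‖ ≤ C * ‖g t‖ := by
    rw [norm_mul]; gcongr; exact hC t
  have ht {l : Filter ℝ} (hl : Tendsto g l (𝓝 0)) : Tendsto (fun t => f t * g t) l (𝓝 0) :=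
    squeeze_zero_norm hle (by simpa using hl.norm.const_mul C)
  cases c with
  | bc0 => exact ⟨mul_mem_BC ⟨hfc, C, hC⟩ hg.1, ht hg.2⟩
  | c00 => exact ⟨⟨mul_mem_BC ⟨hfc, C, hC⟩ hg.1.1, ht hg.1.2⟩, ht hg.2⟩
  | lp => exact MemLp.of_le_mul hg (hfc.aestronglyMeasurable.mul hg.1) (ae_of_all _ hle)
  | lp0 =>
    obtain ⟨hg1, ⟨D, hD⟩, hg2⟩ := hg
    refine ⟨hfc.aestronglyMeasurable.mul hg1, ⟨C * D, fun t ht => (hle t).trans ?_⟩,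
      MemLp.of_le_mul hg2 (hfc.aestronglyMeasurable.mul hg2.1) (ae_of_all _ hle)⟩
    gcongr
    exact hD t ht

theorem add_mem_apType {p : ℝ} (c : Setting) {φ g : ℝ → ℂ} (hφ : φ ∈ AP) (hg : g ∈ BC)
    (hgc : g ∈ c.decaying p) : φ + g ∈ c.apType p := by
  have h := add_mem_BC (mem_BC_of_mem_AP hφ) hg
  cases c with
  | bc0 => exact ⟨h, φ, hφ, g, hgc.2, rfl⟩
  | c00 => exact ⟨h, φ, hφ, g, ⟨hgc.1.2, hgc.2⟩, rfl⟩
  | lp0 => exact ⟨h, φ, hφ, g, hgc, rfl⟩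
  | lp => exact ⟨h, φ, hφ, g, hgc, rfl⟩

theorem mem_BC_of_mem_apType {p : ℝ} (c : Setting) {f : ℝ → ℂ} (hf : f ∈ c.apType p) : f ∈ BC := by
  cases c <;> exact hf.1

/-! ## The fixed point problem -/

/-- The right hand side of the equation for the pair `(u, v) = (ψ, ψ')`. -/
noncomputable def pairTerm (P R B : ℝ → ℂ) (κ : ℂ) (u v : ℝ → ℂ) (t : ℝ) : ℂ :=
  P t + R t * u t + B t * v t + (κ + B t) * u t ^ 2 + 3 * u t * v t + u t ^ 3

theorem pairTerm_mem_BC {P R B : ℝ → ℂ} (hP : P ∈ BC) (hR : R ∈ BC) (hB : B ∈ BC) (κ : ℂ)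
    {u v : ℝ → ℂ} (hu : u ∈ BC) (hv : v ∈ BC) : pairTerm P R B κ u v ∈ BC :=
  add_mem_BC (add_mem_BC (add_mem_BC (add_mem_BC (add_mem_BC hP (mul_mem_BC hR hu))
    (mul_mem_BC hB hv)) (mul_mem_BC (add_mem_BC (const_mem_BC κ) hB) (pow_mem_BC hu 2)))
    (mul_mem_BC (const_mul_mem_BC 3 hu) hv)) (pow_mem_BC hu 3)

/-- The weight `|R| + |B| + τ (c + |B|)`. -/
noncomputable def growthWeight (R B : ℝ → ℂ) (c τ : ℝ) (t : ℝ) : ℝ≥0∞ :=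
  ENNReal.ofReal (‖R t‖ + ‖B t‖ + τ * (c + ‖B t‖))

/-- The summand 1 in c pays for the cross term, since 3xy ≤ (x+y)², and c ≥ 1 pays for the cube. -/
theorem norm_pairTerm_sub_le {P R B : ℝ → ℂ} {κ : ℂ} {c : ℝ} (hc : 1 + ‖κ‖ ≤ c) (u v : ℝ → ℂ)
    (t : ℝ) : ‖pairTerm P R B κ u v t - P t‖ ≤ (‖R t‖ + ‖B t‖) * (‖u t‖ + ‖v t‖) +
      (c + ‖B t‖) * ((1 + (‖u t‖ + ‖v t‖)) * (‖u t‖ + ‖v t‖) ^ 2) := by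
  have e : pairTerm P R B κ u v t - P t = R t * u t + B t * v t + (κ + B t) * u t ^ 2 +
      3 * u t * v t + u t ^ 3 := by unfold pairTerm; ring
  have h1 : ‖κ + B t‖ ≤ c - 1 + ‖B t‖ := (norm_add_le _ _).trans (by linarith)
  have hc0 : 0 ≤ c - 1 := by linarith [norm_nonneg κ]
  rw [e]
  calc _ ≤ ‖R t * u t‖ + ‖B t * v t‖ + ‖(κ + B t) * u t ^ 2‖ + ‖3 * u t * v t‖ + ‖u t ^ 3‖ := by
        refine (norm_add_le _ _).trans (add_le_add_left ((norm_add_le _ _).trans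
          (add_le_add_left ((norm_add_le _ _).trans (add_le_add_left (norm_add_le _ _) _)) _)) _)
    _ = ‖R t‖ * ‖u t‖ + ‖B t‖ * ‖v t‖ + ‖κ + B t‖ * ‖u t‖ ^ 2 + 3 * ‖u t‖ * ‖v t‖ + ‖u t‖ ^ 3 := by
        simp
    _ ≤ ‖R t‖ * ‖u t‖ + ‖B t‖ * ‖v t‖ + (c - 1 + ‖B t‖) * ‖u t‖ ^ 2 + 3 * ‖u t‖ * ‖v t‖ +
        ‖u t‖ ^ 3 := by gcongr
    _ ≤ _ := by
        generalize hx : ‖u t‖ = x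
        generalize hy : ‖v t‖ = y
        generalize hb : ‖B t‖ = b
        generalize hr : ‖R t‖ = ρ
        have hx0 : 0 ≤ x := hx ▸ norm_nonneg _
        have hy0 : 0 ≤ y := hy ▸ norm_nonneg _
        have hb0 : 0 ≤ b := hb ▸ norm_nonneg _
        have hr0 : 0 ≤ ρ := hr ▸ norm_nonneg _
        have k1 : (c - 1 + b) * x ^ 2 ≤ (c - 1 + b) * (x + y) ^ 2 := by gcongr; linarith
        have k2 : 3 * x * y ≤ (x + y) ^ 2 := by nlinarith [sq_nonneg (x - y)]
        have k3 : x ^ 3 ≤ 1 * (x + y) ^ 3 := by rw [one_mul]; gcongr; linarith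
        have k4 : 1 * (x + y) ^ 3 ≤ (c + b) * (x + y) ^ 3 := by gcongr; linarith
        have k5 : 0 ≤ ρ * y + b * x := by positivity
        nlinarith

theorem norm_pairTerm_sub_pairTerm_le {P R B : ℝ → ℂ} {κ : ℂ} {c : ℝ} (hc : 1 + ‖κ‖ ≤ c) {M : ℝ}
    {u v u' v' : ℝ → ℂ} {t : ℝ} (h : ‖u t‖ + ‖v t‖ ≤ M) (h' : ‖u' t‖ + ‖v' t‖ ≤ M) :
    ‖pairTerm P R B κ u v t - pairTerm P R B κ u' v' t‖ ≤
      (‖R t‖ + ‖B t‖ + (3 * M + 3 * M ^ 2) * (c + ‖B t‖)) * (‖u t - u' t‖ + ‖v t - v' t‖) := by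
  have h1 : ‖κ + B t‖ ≤ c - 1 + ‖B t‖ := (norm_add_le _ _).trans (by linarith)
  have hc0 : 0 ≤ c - 1 := by linarith [norm_nonneg κ]
  have hM : 0 ≤ M := by linarith [norm_nonneg (u t), norm_nonneg (v t)]
  have hu : ‖u t‖ ≤ M := by linarith [norm_nonneg (v t)]
  have hu' : ‖u' t‖ ≤ M := by linarith [norm_nonneg (v' t)]
  have hv' : ‖v' t‖ ≤ M := by linarith [norm_nonneg (u' t)]
  -- The cross term is split as 3u(v-v') + 3v'(u-u').
  have e : pairTerm P R B κ u v t - pairTerm P R B κ u' v' t =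
      (R t + (κ + B t) * (u t + u' t) + 3 * v' t + (u t ^ 2 + u t * u' t + u' t ^ 2)) *
        (u t - u' t) + (B t + 3 * u t) * (v t - v' t) := by unfold pairTerm; ring
  have k1 : ‖R t + (κ + B t) * (u t + u' t) + 3 * v' t + (u t ^ 2 + u t * u' t + u' t ^ 2)‖ ≤
      ‖R t‖ + (c - 1 + ‖B t‖) * (M + M) + 3 * M + (M ^ 2 + M * M + M ^ 2) := by
    refine (norm_add_le _ _).trans (add_le_add ((norm_add_le _ _).trans (add_le_add
      ((norm_add_le _ _).trans (add_le_add le_rfl ?_)) ?_)) ((norm_add_le _ _).trans (add_le_add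
      ((norm_add_le _ _).trans (add_le_add ?_ ?_)) ?_)))
    · rw [norm_mul]
      gcongr
      exact (norm_add_le _ _).trans (add_le_add hu hu')
    · rw [norm_mul, Complex.norm_ofNat]; gcongr
    · rw [norm_pow]; gcongr
    · rw [norm_mul]; gcongr
    · rw [norm_pow]; gcongr
  have k2 : ‖B t + 3 * u t‖ ≤ ‖B t‖ + 3 * M := by
    refine (norm_add_le _ _).trans (add_le_add le_rfl ?_)
    rw [norm_mul, Complex.norm_ofNat]; gcongr
  rw [e]
  refine (norm_add_le _ _).trans ?_
  rw [norm_mul, norm_mul, mul_add _ ‖u t - u' t‖]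
  refine add_le_add (mul_le_mul_of_nonneg_right ?_ (norm_nonneg _))
    (mul_le_mul_of_nonneg_right ?_ (norm_nonneg _))
  · refine k1.trans ?_
    have : 0 ≤ ‖B t‖ + ‖B t‖ * M + ‖B t‖ * M ^ 2 + (c - 1) * M + (c - 1) * M ^ 2 := by positivity
    nlinarith
  · refine k2.trans ?_
    have : 0 ≤ ‖B t‖ * M + ‖B t‖ * M ^ 2 + (c - 1) * M + (c - 1) * M ^ 2 + M ^ 2 := by
      positivity
    nlinarith [norm_nonneg (R t)]

theorem measurable_growthWeight {R B : ℝ → ℂ} (hR : R ∈ BC) (hB : B ∈ BC) (c τ : ℝ) :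
    Measurable (growthWeight R B c τ) := by
  have := hR.1
  have := hB.1
  exact ENNReal.measurable_ofReal.comp (by fun_prop : Continuous _).measurable

theorem growthWeight_eq (R B : ℝ → ℂ) {c τ : ℝ} (hc : 0 ≤ c) (hτ : 0 ≤ τ) (t : ℝ) :
    growthWeight R B c τ t =
      (‖R t‖ₑ + ‖B t‖ₑ) + ENNReal.ofReal τ * (ENNReal.ofReal c + ‖B t‖ₑ) := by
  rw [growthWeight, ENNReal.ofReal_add (by positivity) (by positivity),
    ENNReal.ofReal_add (by positivity) (by positivity), ENNReal.ofReal_mul hτ,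
    ENNReal.ofReal_add (by positivity) (by positivity), ofReal_norm, ofReal_norm]

/-- The parameter τ measures the strength of the nonlinearity: M + M² for the self-map and the first
decay rate, 3M + 3M² for the contraction, (1+M)η for a prescribed rate. -/
theorem majorant_growthWeight_le {γ₁ γ₂ : ℂ} {β : ℝ} {R B : ℝ → ℂ} (hR : R ∈ BC) (hB : B ∈ BC)
    {c τ : ℝ} (hc : 0 ≤ c) (hτ : 0 ≤ τ) {L Q : ℝ≥0∞}
    (hL : ∀ t, majorant γ₁ γ₂ β (fun s => ‖R s‖ₑ + ‖B s‖ₑ) t ≤ L)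
    (hQ : ∀ t, majorant γ₁ γ₂ β (fun s => ENNReal.ofReal c + ‖B s‖ₑ) t ≤ Q) (t : ℝ) :
    majorant γ₁ γ₂ β (growthWeight R B c τ) t ≤ L + ENNReal.ofReal τ * Q := by
  rw [funext (growthWeight_eq R B hc hτ)]
  have hm : Measurable fun s => ‖R s‖ₑ + ‖B s‖ₑ := hR.1.measurable.enorm.add hB.1.measurable.enorm
  rw [majorant_add hm, majorant_const_mul ENNReal.ofReal_ne_top]
  gcongr
  exacts [hL t, hQ t]

theorem green_sub {γ₁ γ₂ : ℂ} (h₁ : γ₁.re ≠ 0) (h₂ : γ₂.re ≠ 0) {f g : ℝ → ℂ} (hf : f ∈ BC)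
    (hg : g ∈ BC) (t : ℝ) :
    green γ₁ γ₂ (fun s => f s - g s) t = green γ₁ γ₂ f t - green γ₁ γ₂ g t ∧
    greenDeriv γ₁ γ₂ (fun s => f s - g s) t = greenDeriv γ₁ γ₂ f t - greenDeriv γ₁ γ₂ g t := by
  have e (γ : ℂ) (hγ : γ.re ≠ 0) :
      scalarGreen γ (fun s => f s - g s) t = scalarGreen γ f t - scalarGreen γ g t :=
    scalarGreen_sub hf.1.aestronglyMeasurable hg.1.aestronglyMeasurable
      (absGreen_ne_top_of_mem_BC hγ hf t) (absGreen_ne_top_of_mem_BC hγ hg t)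
  constructor
  · simp only [green, e γ₁ h₁, e γ₂ h₂]; ring
  · simp only [greenDeriv, e γ₁ h₁, e γ₂ h₂]; ring

/-- Real version of the bound by the majorant. -/
theorem norm_green_add_norm_greenDeriv_le {γ₁ γ₂ : ℂ} (h₁ : γ₁.re ≠ 0) (h₂ : γ₂.re ≠ 0)
    {f : ℝ → ℂ} {W : ℝ → ℝ≥0∞} {q d : ℝ} (hq : 0 ≤ q) (hd : 0 ≤ d)
    (hW : ∀ t, majorant γ₁ γ₂ 0 W t ≤ ENNReal.ofReal q)
    (hf : ∀ s, ‖f s‖ₑ ≤ ENNReal.ofReal d * W s) (t : ℝ) :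
    ‖green γ₁ γ₂ f t‖ + ‖greenDeriv γ₁ γ₂ f t‖ ≤ q * d := by
  have h := (enorm_green_add_enorm_greenDeriv_le h₁ h₂ f t).trans (majorant_mono hf t)
  rw [majorant_const_mul ENNReal.ofReal_ne_top] at h
  have h' : ENNReal.ofReal (‖green γ₁ γ₂ f t‖ + ‖greenDeriv γ₁ γ₂ f t‖) ≤ ENNReal.ofReal (q * d) := by
    rw [ENNReal.ofReal_add (norm_nonneg _) (norm_nonneg _), ofReal_norm, ofReal_norm,
      ENNReal.ofReal_mul hq, mul_comm]
    exact h.trans (by gcongr; exact hW t)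
  exact (ENNReal.ofReal_le_ofReal_iff (by positivity)).1 h'

open scoped BoundedContinuousFunction in
-- Banach's theorem on the ball of radius M in the bounded continuous functions with values in ℂ²
-- under the ℓ¹ norm, which matches |Gf| + |(Gf)'|. The derivative is an independent unknown v, so
-- the space carries no differentiability; v = u' follows afterwards from the two equations.
theorem exists_fixedPoint_pair {γ₁ γ₂ : ℂ} (h₁ : γ₁.re ≠ 0) (h₂ : γ₂.re ≠ 0)
    {P R B : ℝ → ℂ} (hP : P ∈ BC) (hR : R ∈ BC) (hB : B ∈ BC) {κ : ℂ} {c : ℝ} (hc : 1 + ‖κ‖ ≤ c)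
    {L Q M H : ℝ} (hL0 : 0 ≤ L) (hQ0 : 0 ≤ Q) (hM : 0 ≤ M)
    (hL : ∀ t, majorant γ₁ γ₂ 0 (fun s => ‖R s‖ₑ + ‖B s‖ₑ) t ≤ ENNReal.ofReal L)
    (hQ : ∀ t, majorant γ₁ γ₂ 0 (fun s => ENNReal.ofReal c + ‖B s‖ₑ) t ≤ ENNReal.ofReal Q)
    (hcontr : L + (3 * M + 3 * M ^ 2) * Q < 1)
    (hH : ∀ t, ‖green γ₁ γ₂ P t‖ + ‖greenDeriv γ₁ γ₂ P t‖ ≤ H)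
    (hself : H + (L + (M + M ^ 2) * Q) * M ≤ M) :
    ∃ u v : ℝ → ℂ, u ∈ BC ∧ v ∈ BC ∧ (∀ t, ‖u t‖ + ‖v t‖ ≤ M) ∧
      (∀ t, u t = -green γ₁ γ₂ (pairTerm P R B κ u v) t) ∧
      ∀ t, v t = -greenDeriv γ₁ γ₂ (pairTerm P R B κ u v) t := by
  have hc0 : 0 ≤ c := by linarith [norm_nonneg κ]
  have hfst (Ψ : ℝ →ᵇ WithLp 1 (ℂ × ℂ)) : (fun t => (Ψ t).fst) ∈ BC :=
    ⟨(WithLp.prod_continuous_ofLp 1 ℂ ℂ |>.comp Ψ.continuous).fst, ‖Ψ‖, fun t => by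
      have := Ψ.norm_coe_le_norm t
      rw [WithLp.prod_norm_eq_of_L1] at this
      linarith [norm_nonneg (Ψ t).snd]⟩
  have hsnd (Ψ : ℝ →ᵇ WithLp 1 (ℂ × ℂ)) : (fun t => (Ψ t).snd) ∈ BC :=
    ⟨(WithLp.prod_continuous_ofLp 1 ℂ ℂ |>.comp Ψ.continuous).snd, ‖Ψ‖, fun t => by
      have := Ψ.norm_coe_le_norm t
      rw [WithLp.prod_norm_eq_of_L1] at this
      linarith [norm_nonneg (Ψ t).fst]⟩
  set F : (ℝ →ᵇ WithLp 1 (ℂ × ℂ)) → ℝ → ℂ := fun Ψ =>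
    pairTerm P R B κ (fun t => (Ψ t).fst) (fun t => (Ψ t).snd) with hF
  have hFBC (Ψ) : F Ψ ∈ BC := pairTerm_mem_BC hP hR hB κ (hfst Ψ) (hsnd Ψ)
  have hG (Ψ) : green γ₁ γ₂ (F Ψ) ∈ BC := green_mem_BC h₁ h₂ (hFBC Ψ)
  have hD (Ψ) : greenDeriv γ₁ γ₂ (F Ψ) ∈ BC := greenDeriv_mem_BC h₁ h₂ (hFBC Ψ)
  have hbd (Ψ) : ∃ C : ℝ, ∀ t,
      ‖(WithLp.toLp 1 (-green γ₁ γ₂ (F Ψ) t, -greenDeriv γ₁ γ₂ (F Ψ) t) : WithLp 1 (ℂ × ℂ))‖ ≤ C := by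
    obtain ⟨-, C, hC⟩ := neg_mem_BC (hG Ψ)
    obtain ⟨-, D, hD⟩ := neg_mem_BC (hD Ψ)
    refine ⟨C + D, fun t => ?_⟩
    rw [WithLp.prod_norm_eq_of_L1]
    exact add_le_add (hC t) (hD t)
  choose b hb using hbd
  set T : (ℝ →ᵇ WithLp 1 (ℂ × ℂ)) → (ℝ →ᵇ WithLp 1 (ℂ × ℂ)) := fun Ψ =>
    BoundedContinuousFunction.ofNormedAddCommGroup
      (fun t => WithLp.toLp 1 (-green γ₁ γ₂ (F Ψ) t, -greenDeriv γ₁ γ₂ (F Ψ) t))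
      ((WithLp.prod_continuous_toLp 1 ℂ ℂ).comp ((hG Ψ).1.neg.prodMk (hD Ψ).1.neg))
      (b Ψ) (hb Ψ) with hT
  have hTapp (Ψ) (t : ℝ) :
      T Ψ t = WithLp.toLp 1 (-green γ₁ γ₂ (F Ψ) t, -greenDeriv γ₁ γ₂ (F Ψ) t) := rfl
  set S : Set (ℝ →ᵇ WithLp 1 (ℂ × ℂ)) := Metric.closedBall 0 M with hS
  have hSm {Ψ} (hΨ : Ψ ∈ S) (t : ℝ) : ‖(Ψ t).fst‖ + ‖(Ψ t).snd‖ ≤ M := by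
    have h := Ψ.norm_coe_le_norm t
    rw [WithLp.prod_norm_eq_of_L1] at h
    exact h.trans (mem_closedBall_zero_iff.1 hΨ)
  have hmaps : Set.MapsTo T S S := by
    intro Ψ hΨ
    rw [hS, mem_closedBall_zero_iff, BoundedContinuousFunction.norm_le hM]
    intro t
    rw [hTapp, WithLp.prod_norm_eq_of_L1]
    change ‖-green γ₁ γ₂ (F Ψ) t‖ + ‖-greenDeriv γ₁ γ₂ (F Ψ) t‖ ≤ M
    rw [norm_neg, norm_neg]
    -- The inhomogeneity is split off so that the bound H on its actual Green potential is used
    -- instead of the larger majorant.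
    have e := green_sub h₁ h₂ (hFBC Ψ) hP t
    have hb := norm_green_add_norm_greenDeriv_le h₁ h₂ (f := fun s => F Ψ s - P s)
      (W := growthWeight R B c (M + M ^ 2)) (q := L + (M + M ^ 2) * Q) (d := M) (by positivity) hM
      (fun t => ?_) (fun s => ?_) t
    · rw [e.1, e.2] at hb
      have k1 := norm_add_le (green γ₁ γ₂ (F Ψ) t - green γ₁ γ₂ P t) (green γ₁ γ₂ P t)
      have k2 := norm_add_le (greenDeriv γ₁ γ₂ (F Ψ) t - greenDeriv γ₁ γ₂ P t) (greenDeriv γ₁ γ₂ P t)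
      rw [sub_add_cancel] at k1 k2
      linarith [hH t]
    · rw [ENNReal.ofReal_add hL0 (by positivity), ENNReal.ofReal_mul (by positivity)]
      exact majorant_growthWeight_le hR hB hc0 (by positivity) hL hQ t
    · rw [growthWeight, ← ENNReal.ofReal_mul hM, ← ofReal_norm]
      refine ENNReal.ofReal_le_ofReal ((norm_pairTerm_sub_le hc _ _ s).trans ?_)
      have hm := hSm hΨ s
      calc _ ≤ (‖R s‖ + ‖B s‖) * M + (c + ‖B s‖) * ((1 + M) * M ^ 2) := by gcongr
        _ = _ := by ring
  set q : ℝ := L + (3 * M + 3 * M ^ 2) * Q with hq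
  have hq0 : 0 ≤ q := by positivity
  have hcontr' : ContractingWith q.toNNReal (hmaps.restrict T S S) := by
    refine ⟨by rw [← Real.toNNReal_one]; exact (Real.toNNReal_lt_toNNReal_iff one_pos).2 hcontr,
      LipschitzWith.of_dist_le_mul fun ⟨Ψ, hΨ⟩ ⟨Φ, hΦ⟩ => ?_⟩
    rw [Subtype.dist_eq, Subtype.dist_eq, Set.MapsTo.val_restrict_apply,
      Set.MapsTo.val_restrict_apply, Real.coe_toNNReal q hq0]
    simp only
    rw [BoundedContinuousFunction.dist_le (by positivity)]
    intro t
    have e := green_sub h₁ h₂ (hFBC Ψ) (hFBC Φ) t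
    have hb := norm_green_add_norm_greenDeriv_le h₁ h₂ (f := fun s => F Ψ s - F Φ s)
      (W := growthWeight R B c (3 * M + 3 * M ^ 2)) (q := q) (d := dist Ψ Φ) hq0 dist_nonneg
      (fun t => ?_) (fun s => ?_) t
    · rw [e.1, e.2] at hb
      rw [hTapp, hTapp, dist_eq_norm, WithLp.prod_norm_eq_of_L1]
      change ‖-green γ₁ γ₂ (F Ψ) t - -green γ₁ γ₂ (F Φ) t‖ +
        ‖-greenDeriv γ₁ γ₂ (F Ψ) t - -greenDeriv γ₁ γ₂ (F Φ) t‖ ≤ _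
      rwa [neg_sub_neg, neg_sub_neg, norm_sub_rev, norm_sub_rev (greenDeriv γ₁ γ₂ (F Φ) t)]
    · rw [hq, ENNReal.ofReal_add hL0 (by positivity), ENNReal.ofReal_mul (by positivity)]
      exact majorant_growthWeight_le hR hB hc0 (by positivity) hL hQ t
    · rw [growthWeight, ← ENNReal.ofReal_mul dist_nonneg, ← ofReal_norm]
      refine ENNReal.ofReal_le_ofReal
        ((norm_pairTerm_sub_pairTerm_le hc (hSm hΨ s) (hSm hΦ s)).trans ?_)
      have hd : ‖(Ψ s).fst - (Φ s).fst‖ + ‖(Ψ s).snd - (Φ s).snd‖ ≤ dist Ψ Φ := by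
        have := Ψ.dist_coe_le_dist (g := Φ) s
        rwa [dist_eq_norm, WithLp.prod_norm_eq_of_L1] at this
      rw [mul_comm (dist Ψ Φ)]
      gcongr
  obtain ⟨Ψ, hΨS, hΨ, -⟩ := hcontr'.exists_fixedPoint' (s := S) Metric.isClosed_closedBall.isComplete
    hmaps (Metric.mem_closedBall_self hM) (edist_ne_top 0 (T 0))
  have hfix (t : ℝ) : Ψ t = WithLp.toLp 1 (-green γ₁ γ₂ (F Ψ) t, -greenDeriv γ₁ γ₂ (F Ψ) t) := by
    rw [← hTapp, hΨ.eq]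
  exact ⟨_, _, hfst Ψ, hsnd Ψ, hSm hΨS, fun t => congrArg WithLp.fst (hfix t),
    fun t => congrArg WithLp.snd (hfix t)⟩

/-! ## Decay of the fixed point -/

theorem enorm_pairTerm_le {P R B : ℝ → ℂ} {κ : ℂ} {c : ℝ} (hc : 1 + ‖κ‖ ≤ c) (u v : ℝ → ℂ)
    (t : ℝ) : ‖pairTerm P R B κ u v t‖ₑ ≤ ‖P t‖ₑ + ((‖R t‖ₑ + ‖B t‖ₑ) * (‖u t‖ₑ + ‖v t‖ₑ) +
      (ENNReal.ofReal c + ‖B t‖ₑ) * ((1 + (‖u t‖ₑ + ‖v t‖ₑ)) * (‖u t‖ₑ + ‖v t‖ₑ) ^ 2)) := by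
  have hc0 : 0 ≤ c := by linarith [norm_nonneg κ]
  have h : ‖pairTerm P R B κ u v t - P t‖ₑ ≤ (‖R t‖ₑ + ‖B t‖ₑ) * (‖u t‖ₑ + ‖v t‖ₑ) +
      (ENNReal.ofReal c + ‖B t‖ₑ) * ((1 + (‖u t‖ₑ + ‖v t‖ₑ)) * (‖u t‖ₑ + ‖v t‖ₑ) ^ 2) := by
    rw [← ofReal_norm]
    refine (ENNReal.ofReal_le_ofReal (norm_pairTerm_sub_le hc u v t)).trans_eq ?_
    simp only [← ofReal_norm, ← ENNReal.ofReal_one]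
    repeat rw [← ENNReal.ofReal_add (by positivity) (by positivity)]
    rw [← ENNReal.ofReal_pow (by positivity), ← ENNReal.ofReal_mul (by positivity),
      ← ENNReal.ofReal_mul (by positivity), ← ENNReal.ofReal_mul (by positivity),
      ← ENNReal.ofReal_add (by positivity) (by positivity)]
  calc _ = ‖P t + (pairTerm P R B κ u v t - P t)‖ₑ := by rw [add_sub_cancel]
    _ ≤ _ := (enorm_add_le _ _).trans (by gcongr)

/-- The fixed point decays at least like an exponential convolution of the inhomogeneity. -/
theorem exists_rate_pair_le_expConv {γ₁ γ₂ : ℂ} (h₁ : γ₁.re ≠ 0) (h₂ : γ₂.re ≠ 0)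
    {P R B : ℝ → ℂ} (hP : P ∈ BC) (hR : R ∈ BC) (hB : B ∈ BC) {κ : ℂ} {c : ℝ} (hc : 1 + ‖κ‖ ≤ c)
    {M : ℝ} (hM : 0 ≤ M) {L Q : ℝ≥0∞}
    (hL : ∀ t, majorant γ₁ γ₂ 0 (fun s => ‖R s‖ₑ + ‖B s‖ₑ) t ≤ L)
    (hQ : ∀ t, majorant γ₁ γ₂ 0 (fun s => ENNReal.ofReal c + ‖B s‖ₑ) t ≤ Q)
    (hLQ : L + ENNReal.ofReal (M + M ^ 2) * Q < 1) {u v : ℝ → ℂ}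
    (huv : ∀ t, ‖u t‖ₑ + ‖v t‖ₑ ≤ ENNReal.ofReal M)
    (hm : ∀ t, ‖u t‖ₑ + ‖v t‖ₑ ≤ majorant γ₁ γ₂ 0 (fun s => ‖pairTerm P R B κ u v s‖ₑ) t) :
    ∃ β : ℝ, 0 < β ∧ ∃ C : ℝ≥0∞, C ≠ ⊤ ∧
      ∀ t, ‖u t‖ₑ + ‖v t‖ₑ ≤ C * expConv β (fun s => ‖P s‖ₑ) t := by
  have hc0 : 0 ≤ c := by linarith [norm_nonneg κ]
  set W := growthWeight R B c (M + M ^ 2) with hW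
  have hWm : Measurable W := measurable_growthWeight hR hB c _
  obtain ⟨DR, hDR, hRD⟩ := exists_enorm_le_of_mem_BC hR
  obtain ⟨DB, hDB, hBD⟩ := exists_enorm_le_of_mem_BC hB
  -- The weight contains the nonlinearity already linearised at size M, so it is the full bound L +
  -- (M+M²)Q < 1 that is twisted.
  obtain ⟨β, hβ, hβ₁, hβ₂, q, hq, hWq⟩ := exists_twist_majorant_lt_one h₁ h₂ hWm
    (C := (DR + DB) + ENNReal.ofReal (M + M ^ 2) * (ENNReal.ofReal c + DB)) (by finiteness)
    (fun s => by
      rw [hW, growthWeight_eq R B hc0 (by positivity)]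
      gcongr
      exacts [hRD s, hBD s, hBD s])
    hLQ (majorant_growthWeight_le hR hB hc0 (by positivity) hL hQ)
  refine ⟨β, hβ, (weight γ₁ γ₂ γ₁ + weight γ₁ γ₂ γ₂) * (1 - q)⁻¹, ?_, ?_⟩
  · exact ENNReal.mul_ne_top (ENNReal.add_ne_top.2 ⟨weight_ne_top _ _ _, weight_ne_top _ _ _⟩)
      (ENNReal.inv_ne_top.2 (tsub_pos_of_lt hq).ne')
  refine le_expConv_of_le_majorant h₁ h₂ hβ.le hβ₁ hβ₂ hWm hP.1.measurable.enorm hq hWq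
    (B := ENNReal.ofReal M) ENNReal.ofReal_ne_top huv
    (ENNReal.add_ne_top.2 ⟨weight_ne_top _ _ _, weight_ne_top _ _ _⟩) fun t => ?_
  calc ‖u t‖ₑ + ‖v t‖ₑ ≤ majorant γ₁ γ₂ 0 (fun s => ‖pairTerm P R B κ u v s‖ₑ) t := hm t
    _ ≤ majorant γ₁ γ₂ 0 (fun s => ‖P s‖ₑ + W s * (‖u s‖ₑ + ‖v s‖ₑ)) t := by
        refine majorant_mono (fun s => (enorm_pairTerm_le hc u v s).trans ?_) t
        rw [hW, growthWeight_eq R B hc0 (by positivity), add_mul (‖R s‖ₑ + ‖B s‖ₑ)]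
        refine add_le_add le_rfl (add_le_add le_rfl ?_)
        -- With m = |u| + |v| ≤ M, two of the bounded factors are frozen: (1+m)m² ≤ (1+M)M·m.
        calc _ = (ENNReal.ofReal c + ‖B s‖ₑ) * (((1 + (‖u s‖ₑ + ‖v s‖ₑ)) * (‖u s‖ₑ + ‖v s‖ₑ)) *
              (‖u s‖ₑ + ‖v s‖ₑ)) := by ring
          _ ≤ (ENNReal.ofReal c + ‖B s‖ₑ) * (((1 + ENNReal.ofReal M) * ENNReal.ofReal M) *
              (‖u s‖ₑ + ‖v s‖ₑ)) := by gcongr <;> exact huv s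
          _ = _ := by
              rw [ENNReal.ofReal_add hM (by positivity), ENNReal.ofReal_pow hM]
              ring
    _ = majorant γ₁ γ₂ 0 (fun s => ‖P s‖ₑ) t +
        majorant γ₁ γ₂ 0 (fun s => W s * (‖u s‖ₑ + ‖v s‖ₑ)) t :=
        majorant_add hP.1.measurable.enorm _ t
    _ ≤ _ := by
        gcongr
        exact majorant_zero_le_expConv h₁ h₂ hβ₁ hβ₂ _ t

/-- Once some exponential rate is known, every rate allowed by the linear part is attained. -/
theorem pair_le_expConv {γ₁ γ₂ : ℂ} (h₁ : γ₁.re ≠ 0) (h₂ : γ₂.re ≠ 0)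
    {P R B : ℝ → ℂ} (hP : P ∈ BC) (hR : R ∈ BC) (hB : B ∈ BC) {κ : ℂ} {c : ℝ} (hc : 1 + ‖κ‖ ≤ c)
    {M : ℝ} (hM : 0 ≤ M) {β : ℝ} (hβ : 0 ≤ β) (hβ₁ : β < |γ₁.re|) (hβ₂ : β < |γ₂.re|)
    {L Q : ℝ≥0∞} (hL1 : L < 1) (hQt : Q ≠ ⊤)
    (hL : ∀ t, majorant γ₁ γ₂ β (fun s => ‖R s‖ₑ + ‖B s‖ₑ) t ≤ L)
    (hQ : ∀ t, majorant γ₁ γ₂ β (fun s => ENNReal.ofReal c + ‖B s‖ₑ) t ≤ Q) {u v : ℝ → ℂ}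
    (hu : u ∈ BC) (hv : v ∈ BC)
    (huv : ∀ t, ‖u t‖ₑ + ‖v t‖ₑ ≤ ENNReal.ofReal M)
    (hm : ∀ t, ‖u t‖ₑ + ‖v t‖ₑ ≤ majorant γ₁ γ₂ 0 (fun s => ‖pairTerm P R B κ u v s‖ₑ) t)
    {δ : ℝ} (hδ : 0 < δ) {D : ℝ≥0∞} (hD : D ≠ ⊤)
    (huvD : ∀ t, ‖u t‖ₑ + ‖v t‖ₑ ≤ D * expConv δ (fun s => ‖P s‖ₑ) t) :
    ∃ C : ℝ≥0∞, C ≠ ⊤ ∧ ∀ t, ‖u t‖ₑ + ‖v t‖ₑ ≤ C * expConv β (fun s => ‖P s‖ₑ) t := by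
  have hc0 : 0 ≤ c := by linarith [norm_nonneg κ]
  obtain ⟨CP, hCP, hPC⟩ := exists_enorm_le_of_mem_BC hP
  -- The number η is small enough that adding (1+M)ηQ to the linear part keeps it below 1.
  obtain ⟨η, hη, hηq⟩ : ∃ η : ℝ, 0 < η ∧ L + ENNReal.ofReal ((1 + M) * η) * Q < 1 := by
    have hlim : Tendsto (fun η : ℝ => L + ENNReal.ofReal ((1 + M) * η) * Q) (𝓝[>] 0)
        (𝓝 (L + ENNReal.ofReal ((1 + M) * 0) * Q)) := by
      refine tendsto_const_nhds.add (ENNReal.Tendsto.mul_const ?_ (Or.inr hQt))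
      exact ((ENNReal.continuous_ofReal.comp (continuous_const_mul (1 + M))).tendsto 0).mono_left
        nhdsWithin_le_nhds
    rw [mul_zero, ENNReal.ofReal_zero, zero_mul, add_zero] at hlim
    obtain ⟨η, h, hη⟩ := ((hlim.eventually_lt_const hL1).and self_mem_nhdsWithin).exists
    exact ⟨η, hη, h⟩
  -- The denominator D + 1 keeps the quotient meaningful when D = 0 and still gives D·η/(D+1) ≤ η.
  have hη' : 0 < ENNReal.ofReal η / (D + 1) :=
    ENNReal.div_pos (ENNReal.ofReal_pos.2 hη).ne' (by finiteness)
  obtain ⟨A, hA, hAE⟩ := exists_expConv_le_add hβ hδ hP.1.measurable.enorm hCP hPC hη'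
  set E := expConv β fun s => ‖P s‖ₑ with hE
  have hEm : Measurable E := measurable_expConv β hP.1.measurable.enorm
  have huvA (t : ℝ) : ‖u t‖ₑ + ‖v t‖ₑ ≤ D * A * E t + ENNReal.ofReal η := by
    refine (huvD t).trans ((mul_le_mul_right (hAE t) D).trans ?_)
    rw [mul_add, ← mul_assoc]
    gcongr
    calc D * (ENNReal.ofReal η / (D + 1)) ≤ (D + 1) * (ENNReal.ofReal η / (D + 1)) := by
          gcongr; exact le_self_add
      _ ≤ _ := ENNReal.mul_div_le
  set W := growthWeight R B c ((1 + M) * η) with hW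
  have hWm : Measurable W := measurable_growthWeight hR hB c _
  -- In (1+m)m² one factor m is replaced by DA·E + η. The η part joins the weight; the E part, with
  -- the other factors bounded by M, becomes K times an inhomogeneity already controlled by E.
  set K : ℝ≥0∞ := (1 + ENNReal.ofReal M) * (D * A) * ENNReal.ofReal M with hK
  have hKt : K ≠ ⊤ := by finiteness
  have hwt : weight γ₁ γ₂ γ₁ + weight γ₁ γ₂ γ₂ ≠ ⊤ :=
    ENNReal.add_ne_top.2 ⟨weight_ne_top _ _ _, weight_ne_top _ _ _⟩
  have hCt : weight γ₁ γ₂ γ₁ + weight γ₁ γ₂ γ₂ + K * Q ≠ ⊤ := by finiteness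
  refine ⟨(weight γ₁ γ₂ γ₁ + weight γ₁ γ₂ γ₂ + K * Q) *
    (1 - (L + ENNReal.ofReal ((1 + M) * η) * Q))⁻¹,
    ENNReal.mul_ne_top hCt (ENNReal.inv_ne_top.2 (tsub_pos_of_lt hηq).ne'), ?_⟩
  refine le_expConv_of_le_majorant h₁ h₂ hβ hβ₁ hβ₂ hWm hP.1.measurable.enorm hηq
    (majorant_growthWeight_le hR hB hc0 (by positivity) hL hQ)
    (B := ENNReal.ofReal M) ENNReal.ofReal_ne_top huv hCt fun t => ?_
  have hBm : Measurable fun s => ENNReal.ofReal c + ‖B s‖ₑ := measurable_const.add hB.1.measurable.enorm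
  have hm₂ : Measurable fun s => W s * (‖u s‖ₑ + ‖v s‖ₑ) :=
    hWm.mul (hu.1.measurable.enorm.add hv.1.measurable.enorm)
  calc ‖u t‖ₑ + ‖v t‖ₑ ≤ majorant γ₁ γ₂ 0 (fun s => ‖pairTerm P R B κ u v s‖ₑ) t := hm t
    _ ≤ majorant γ₁ γ₂ 0 (fun s => ‖P s‖ₑ + (W s * (‖u s‖ₑ + ‖v s‖ₑ) +
        K * ((ENNReal.ofReal c + ‖B s‖ₑ) * E s))) t := by
        refine majorant_mono (fun s => (enorm_pairTerm_le hc u v s).trans ?_) t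
        rw [hW, growthWeight_eq R B hc0 (by positivity), add_mul (‖R s‖ₑ + ‖B s‖ₑ), add_assoc ((‖R s‖ₑ + ‖B s‖ₑ) * _)]
        refine add_le_add le_rfl (add_le_add le_rfl ?_)
        calc _ = (ENNReal.ofReal c + ‖B s‖ₑ) * ((1 + (‖u s‖ₑ + ‖v s‖ₑ)) *
              ((‖u s‖ₑ + ‖v s‖ₑ) * (‖u s‖ₑ + ‖v s‖ₑ))) := by ring
          _ ≤ (ENNReal.ofReal c + ‖B s‖ₑ) * ((1 + ENNReal.ofReal M) *
              ((D * A * E s + ENNReal.ofReal η) * (‖u s‖ₑ + ‖v s‖ₑ))) := by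
              exact mul_le_mul' le_rfl
                (mul_le_mul' (add_le_add le_rfl (huv s)) (mul_le_mul' (huvA s) le_rfl))
          _ = ENNReal.ofReal ((1 + M) * η) * (ENNReal.ofReal c + ‖B s‖ₑ) * (‖u s‖ₑ + ‖v s‖ₑ) +
              (1 + ENNReal.ofReal M) * (D * A) * (‖u s‖ₑ + ‖v s‖ₑ) *
                ((ENNReal.ofReal c + ‖B s‖ₑ) * E s) := by
              rw [ENNReal.ofReal_mul (by positivity), ENNReal.ofReal_add zero_le_one hM,
                ENNReal.ofReal_one]
              ring
          _ ≤ _ := by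
              rw [hK]
              gcongr
              exact huv s
    _ = majorant γ₁ γ₂ 0 (fun s => ‖P s‖ₑ) t +
        (majorant γ₁ γ₂ 0 (fun s => W s * (‖u s‖ₑ + ‖v s‖ₑ)) t +
          K * majorant γ₁ γ₂ 0 (fun s => (ENNReal.ofReal c + ‖B s‖ₑ) * E s) t) := by
        rw [majorant_add hP.1.measurable.enorm, majorant_add hm₂, majorant_const_mul hKt]
    _ ≤ (weight γ₁ γ₂ γ₁ + weight γ₁ γ₂ γ₂) * E t +
        (majorant γ₁ γ₂ 0 (fun s => W s * (‖u s‖ₑ + ‖v s‖ₑ)) t + K * (Q * E t)) := by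
        gcongr
        · exact majorant_zero_le_expConv h₁ h₂ hβ₁ hβ₂ _ t
        · refine (majorant_expConv_le h₁ h₂ hβ hβ₁ hβ₂ hBm _ t).trans ?_
          gcongr
          exact hQ t
    _ = _ := by ring

/-! ## The smallness constants -/

theorem weight_sub_sub (lam lam₁ lam₂ γ : ℂ) :
    weight (lam₁ - lam) (lam₂ - lam) γ = weight lam₁ lam₂ γ := by
  simp [weight]

theorem lintegral_twistedKernel_mul_enorm_le (β : ℝ) (γ : ℂ) (f : ℝ → ℂ) (t : ℝ) :
    ∫⁻ s, twistedKernel β γ t s * ‖f s‖ₑ ≤ supAbsGreen β γ f := by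
  refine le_trans (le_of_eq ?_) (le_iSup _ t)
  rw [absGreen_eq]; rfl

theorem majorant_le_Lconst {a : Fin 3 → ℂ} {r : Fin 3 → ℝ → ℂ} {lam lam₁ lam₂ : ℂ} {β : ℝ}
    {θ : ℝ → ℂ} (hR : Measurable (rTheta a r lam θ)) (t : ℝ) :
    majorant (lam₁ - lam) (lam₂ - lam) β
      (fun s => ‖rTheta a r lam θ s‖ₑ + ‖r 2 s + 3 * θ s‖ₑ) t ≤ Lconst a r lam lam₁ lam₂ β θ := by
  have key (γ : ℂ) : ∫⁻ s, twistedKernel β γ t s * (‖rTheta a r lam θ s‖ₑ + ‖r 2 s + 3 * θ s‖ₑ) ≤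
      supAbsGreen β γ (rTheta a r lam θ) + supAbsGreen β γ (fun t => r 2 t + 3 * θ t) := by
    have hm : Measurable fun s => twistedKernel β γ t s * ‖rTheta a r lam θ s‖ₑ :=
      (measurable_twistedKernel β γ t).mul hR.enorm
    simp_rw [mul_add]
    rw [lintegral_add_left hm]
    exact add_le_add (lintegral_twistedKernel_mul_enorm_le β γ _ t)
      (lintegral_twistedKernel_mul_enorm_le β γ (fun t => r 2 t + 3 * θ t) t)
  unfold majorant Lconst Lsummand
  rw [weight_sub_sub, weight_sub_sub]
  gcongr <;> exact key _

theorem majorant_le_Qconst {a : Fin 3 → ℂ} {r : Fin 3 → ℝ → ℂ} {lam lam₁ lam₂ : ℂ}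
    (h₁ : (lam₁ - lam).re ≠ 0) (h₂ : (lam₂ - lam).re ≠ 0) {β : ℝ} (hβ₁ : β < |(lam₁ - lam).re|)
    (hβ₂ : β < |(lam₂ - lam).re|) {θ : ℝ → ℂ} (t : ℝ) :
    majorant (lam₁ - lam) (lam₂ - lam) β
      (fun s => ENNReal.ofReal (1 + 3 * ‖lam‖ + ‖a 2‖) + ‖r 2 s + 3 * θ s‖ₑ) t ≤
      Qconst a r lam lam₁ lam₂ β θ := by
  have key (γ : ℂ) (hγ : γ.re ≠ 0) (hβγ : β < |γ.re|) :
      ∫⁻ s, twistedKernel β γ t s *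
        (ENNReal.ofReal (1 + 3 * ‖lam‖ + ‖a 2‖) + ‖r 2 s + 3 * θ s‖ₑ) ≤
      ENNReal.ofReal ((1 + 3 * ‖lam‖ + ‖a 2‖) / |γ.re - Real.sign γ.re * β|) +
        supAbsGreen β γ (fun t => r 2 t + 3 * θ t) := by
    have hm : Measurable fun s => twistedKernel β γ t s * ENNReal.ofReal (1 + 3 * ‖lam‖ + ‖a 2‖) :=
      (measurable_twistedKernel β γ t).mul measurable_const
    simp_rw [mul_add]
    rw [lintegral_add_left hm, lintegral_mul_const _ (measurable_twistedKernel β γ t),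
      lintegral_twistedKernel hγ hβγ, ← ENNReal.ofReal_mul (by positivity), one_div_mul_eq_div]
    gcongr
    exact lintegral_twistedKernel_mul_enorm_le β γ (fun t => r 2 t + 3 * θ t) t
  unfold majorant Qconst Qsummand
  rw [weight_sub_sub, weight_sub_sub]
  gcongr
  · exact key _ h₁ hβ₁
  · exact key _ h₂ hβ₂

theorem Qconst_ne_top {a : Fin 3 → ℂ} {r : Fin 3 → ℝ → ℂ} {lam lam₁ lam₂ : ℂ}
    (h₁ : (lam₁ - lam).re ≠ 0) (h₂ : (lam₂ - lam).re ≠ 0) {β : ℝ} (hβ₁ : β < |(lam₁ - lam).re|)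
    (hβ₂ : β < |(lam₂ - lam).re|) {θ : ℝ → ℂ} (hB : (fun t => r 2 t + 3 * θ t) ∈ BC) :
    Qconst a r lam lam₁ lam₂ β θ ≠ ⊤ := by
  obtain ⟨D, hD, hBD⟩ := exists_enorm_le_of_mem_BC hB
  have key (γ : ℂ) (hγ : γ.re ≠ 0) (hβγ : β < |γ.re|) :
      Qsummand a r lam lam₁ lam₂ β θ γ ≠ ⊤ := by
    refine ENNReal.mul_ne_top (weight_ne_top _ _ _) (ENNReal.add_ne_top.2 ⟨ENNReal.ofReal_ne_top, ?_⟩)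
    have hne : ((γ.re - Real.sign γ.re * β : ℝ) : ℂ).re ≠ 0 := by
      rw [Complex.ofReal_re, ← abs_pos, (sign_twist hγ hβγ).1]
      linarith
    exact ne_top_of_le_ne_top (ENNReal.mul_ne_top ENNReal.ofReal_ne_top hD)
      (iSup_le fun t => absGreen_le_of_bound hne hBD t)
  exact ENNReal.add_ne_top.2 ⟨key _ h₁ hβ₁, key _ h₂ hβ₂⟩

theorem Qconst_zero_pos {a : Fin 3 → ℂ} {r : Fin 3 → ℝ → ℂ} {lam lam₁ lam₂ : ℂ}
    (h₁ : (lam₁ - lam).re ≠ 0) (h₁₂ : lam₁ ≠ lam₂) {θ : ℝ → ℂ} :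
    0 < Qconst a r lam lam₁ lam₂ 0 θ := by
  have h : 0 < |(lam₁ - lam).re - Real.sign (lam₁ - lam).re * 0| := by
    rw [mul_zero, sub_zero]; exact abs_pos.2 h₁
  refine add_pos_of_pos_of_nonneg (ENNReal.mul_pos (weight_pos h₁₂ _).ne' ?_) zero_le
  exact (add_pos_of_pos_of_nonneg (ENNReal.ofReal_pos.2 (by positivity)) zero_le).ne'

/-- If the smallness constant is finite, then `θ'` has bounded absolute Green potentials. -/
theorem exists_absGreen_deriv_le {a : Fin 3 → ℂ} {r : Fin 3 → ℝ → ℂ} {lam lam₁ lam₂ : ℂ}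
    (h₁₂ : lam₁ ≠ lam₂) {θ : ℝ → ℂ} (hr : ∀ i, r i ∈ BC) (hθ : θ ∈ BC) {γ : ℂ} (hγ : γ.re ≠ 0)
    (hL : Lsummand a r lam lam₁ lam₂ 0 θ γ ≠ ⊤) :
    ∃ C : ℝ≥0∞, C ≠ ⊤ ∧ ∀ t, absGreen γ (deriv θ) t ≤ C := by
  have hA : (fun t => 2 * lam * r 2 t + r 1 t + 2 * ((3 * lam + a 2 + r 2 t) * θ t) + 3 * θ t ^ 2) ∈ BC :=
    add_mem_BC (add_mem_BC (add_mem_BC (const_mul_mem_BC _ (hr 2)) (hr 1)) (const_mul_mem_BC _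
      (mul_mem_BC (add_mem_BC (const_mem_BC _) (hr 2)) hθ))) (const_mul_mem_BC _ (pow_mem_BC hθ 2))
  set A : ℝ → ℂ := fun t =>
    2 * lam * r 2 t + r 1 t + 2 * ((3 * lam + a 2 + r 2 t) * θ t) + 3 * θ t ^ 2 with hAdef
  obtain ⟨D, hD, hAD⟩ := exists_enorm_le_of_mem_BC hA
  -- The weight is positive, so an infinite supremum would make the summand of L infinite.
  have hs : supAbsGreen 0 γ (rTheta a r lam θ) ≠ ⊤ := by
    intro h
    refine hL ?_
    rw [Lsummand, h, top_add]
    exact ENNReal.mul_top (weight_pos h₁₂ γ).ne'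
  refine ⟨supAbsGreen 0 γ (rTheta a r lam θ) + ENNReal.ofReal (1 / |γ.re|) * D, by finiteness,
    fun t => ?_⟩
  -- r_θ contains 3θ' and otherwise only bounded terms, so θ' is controlled by r_θ.
  have hle (s : ℝ) : ‖deriv θ s‖ₑ ≤ ‖rTheta a r lam θ s‖ₑ + ‖A s‖ₑ := by
    have e : 3 * deriv θ s = rTheta a r lam θ s - A s := by
      simp only [rTheta, hAdef]; ring
    calc ‖deriv θ s‖ₑ ≤ ‖(3 : ℂ)‖ₑ * ‖deriv θ s‖ₑ := by
          refine le_mul_of_one_le_left' ?_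
          rw [← ofReal_norm, Complex.norm_ofNat]
          exact ENNReal.one_le_ofReal.2 (by norm_num)
      _ ≤ _ := by rw [← enorm_mul, e]; exact enorm_sub_le
  calc absGreen γ (deriv θ) t
      ≤ ∫⁻ s, (twistedKernel 0 γ t s * ‖rTheta a r lam θ s‖ₑ + ‖greenKernel γ t s‖ₑ * ‖A s‖ₑ) := by
        rw [absGreen_eq]
        refine lintegral_mono fun s => ?_
        simp only
        rw [twistedKernel_zero γ hγ, ← mul_add]
        gcongr
        exact hle s
    _ = (∫⁻ s, twistedKernel 0 γ t s * ‖rTheta a r lam θ s‖ₑ) + absGreen γ A t := by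
        have hm : Measurable fun s => ‖greenKernel γ t s‖ₑ * ‖A s‖ₑ :=
          (measurable_greenKernel γ t).enorm.mul hA.1.measurable.enorm
        rw [lintegral_add_right _ hm, absGreen_eq]
    _ ≤ _ := by
        gcongr
        · exact lintegral_twistedKernel_mul_enorm_le 0 γ _ t
        · exact absGreen_le_of_bound hγ hAD t

/-- Since 3M + 1 is the square root in the definition, M is the positive root of Q(9M²+6M) = 1 - L.
Substituting this for 1 - L makes the smallness bound a polynomial in M. -/
theorem Mconst_pos_and_identities {L Q : ℝ} (hL : L < 1) (hQ : 0 < Q) :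
    0 < Mconst L Q ∧ L + Q * (9 * Mconst L Q ^ 2 + 6 * Mconst L Q) = 1 ∧
      smallnessBound L Q = Q * (6 * Mconst L Q ^ 3 + 3 * Mconst L Q ^ 2) := by
  have hx : 0 < (1 - L) / Q := div_pos (by linarith) hQ
  have hs1 : 1 < Real.sqrt (1 + (1 - L) / Q) := Real.lt_sqrt_of_sq_lt (by linarith)
  have hsq : Real.sqrt (1 + (1 - L) / Q) ^ 2 = 1 + (1 - L) / Q := Real.sq_sqrt (by linarith)
  have e : 3 * Mconst L Q + 1 = Real.sqrt (1 + (1 - L) / Q) := by rw [Mconst]; ring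
  have h0 : 0 < Mconst L Q := by linarith
  have h1 : Q * (9 * Mconst L Q ^ 2 + 6 * Mconst L Q) = 1 - L := by
    have : 9 * Mconst L Q ^ 2 + 6 * Mconst L Q = (1 - L) / Q := by
      rw [← e] at hsq; linarith
    rw [this, mul_div_cancel₀ _ hQ.ne']
  refine ⟨h0, by linarith, ?_⟩
  rw [smallnessBound, ← h1]
  ring

/-! ## The third order equation -/

/-- These are P''(λ)/2, P'(λ) and P(λ), the Taylor coefficients of x(x-γ₁)(x-γ₂). Distinctness of
the roots permits dividing the differences of the root equations. -/
theorem charPoly_roots {a : Fin 3 → ℂ} {lam lam₁ lam₂ : ℂ}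
    (hlam : (charPoly a).IsRoot lam) (hlam₁ : (charPoly a).IsRoot lam₁)
    (hlam₂ : (charPoly a).IsRoot lam₂) (h₁ : lam₁ ≠ lam) (h₂ : lam₂ ≠ lam) (h₁₂ : lam₁ ≠ lam₂) :
    3 * lam + a 2 = -((lam₁ - lam) + (lam₂ - lam)) ∧
      3 * lam ^ 2 + 2 * a 2 * lam + a 1 = (lam₁ - lam) * (lam₂ - lam) ∧
      lam ^ 3 + a 2 * lam ^ 2 + a 1 * lam + a 0 = 0 := by
  simp only [charPoly, Polynomial.IsRoot, Polynomial.eval_add, Polynomial.eval_mul,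
    Polynomial.eval_pow, Polynomial.eval_X, Polynomial.eval_C] at hlam hlam₁ hlam₂
  have k₁ : lam₁ ^ 2 + lam₁ * lam + lam ^ 2 + a 2 * (lam₁ + lam) + a 1 = 0 := by
    refine mul_left_cancel₀ (sub_ne_zero.2 h₁) ?_
    linear_combination hlam₁ - hlam
  have k₂ : lam₂ ^ 2 + lam₂ * lam + lam ^ 2 + a 2 * (lam₂ + lam) + a 1 = 0 := by
    refine mul_left_cancel₀ (sub_ne_zero.2 h₂) ?_
    linear_combination hlam₂ - hlam
  have k : lam₁ + lam₂ + lam + a 2 = 0 := by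
    refine mul_left_cancel₀ (sub_ne_zero.2 h₁₂) ?_
    linear_combination k₁ - k₂
  refine ⟨by linear_combination k, ?_, hlam⟩
  linear_combination k₁ + (lam - lam₁) * k

/-- The exponent is λt plus a primitive of -G[F]: as (G_γ[F])' = γG_γ[F] + F and 1/(Γ₁γ₁) + 1/(Γ₂γ₂)
= -1/(γ₁γ₂), the integral of F cancels the extra terms F. -/
theorem hasDerivAt_solutionFormula {lam γ₁ γ₂ : ℂ} (h₁ : γ₁.re ≠ 0) (h₂ : γ₂.re ≠ 0)
    (h₁₂ : γ₁ ≠ γ₂) {F : ℝ → ℂ} (hF : F ∈ BC) (t : ℝ) :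
    HasDerivAt (solutionFormula lam γ₁ γ₂ F)
      ((lam - green γ₁ γ₂ F t) * solutionFormula lam γ₁ γ₂ F t) t := by
  have hI : HasDerivAt (fun t : ℝ => ∫ s in (0 : ℝ)..t, F s) (F t) t :=
    (hF.1.integral_hasStrictDerivAt 0 t).hasDerivAt
  have H₁ := hasDerivAt_scalarGreen h₁ hF.1 (absGreen_ne_top_of_mem_BC h₁ hF) t
  have H₂ := hasDerivAt_scalarGreen h₂ hF.1 (absGreen_ne_top_of_mem_BC h₂ hF) t
  have h := ((hasDerivAt_cexp_ofReal lam t).mul (hI.const_mul (γ₁⁻¹ * γ₂⁻¹)).neg.cexp).mul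
    ((H₁.const_mul (1 / ((γ₁ - γ₂) * γ₁))).add (H₂.const_mul (1 / ((γ₂ - γ₁) * γ₂)))).neg.cexp
  refine h.congr_deriv ?_
  have n₁ : γ₁ ≠ 0 := fun h => h₁ (by simp [h])
  have n₂ : γ₂ ≠ 0 := fun h => h₂ (by simp [h])
  have n₁₂ : γ₁ - γ₂ ≠ 0 := sub_ne_zero.2 h₁₂
  have n₂₁ : γ₂ - γ₁ ≠ 0 := sub_ne_zero.2 h₁₂.symm
  have e : -(γ₁⁻¹ * γ₂⁻¹ * F t) - (1 / ((γ₁ - γ₂) * γ₁) * (γ₁ * scalarGreen γ₁ F t + F t) +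
      1 / ((γ₂ - γ₁) * γ₂) * (γ₂ * scalarGreen γ₂ F t + F t)) = -green γ₁ γ₂ F t := by
    have e' : (γ₂ - γ₁) = -(γ₁ - γ₂) := by ring
    rw [green, e']
    field_simp
    ring
  simp only [solutionFormula, Pi.mul_apply, Pi.neg_apply, Pi.add_apply]
  linear_combination (Complex.exp (lam * t) * Complex.exp (-(γ₁⁻¹ * γ₂⁻¹ * ∫ s in (0 : ℝ)..t, F s)) *
    Complex.exp (-(1 / ((γ₁ - γ₂) * γ₁) * scalarGreen γ₁ F t
      + 1 / ((γ₂ - γ₁) * γ₂) * scalarGreen γ₂ F t))) * e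

/-- From y' = wy follow y'' = (w'+w²)y and y''' = (w''+3ww'+w³)y, so the equation is y times the
Riccati equation of w. -/
theorem isSolution_of_logDeriv {a : Fin 3 → ℂ} {r : Fin 3 → ℝ → ℂ} {w w' w'' y : ℝ → ℂ}
    (hy : ∀ t, HasDerivAt y (w t * y t) t) (hw : ∀ t, HasDerivAt w (w' t) t)
    (hw' : ∀ t, HasDerivAt w' (w'' t) t) (hw'' : Continuous w'')
    (h : ∀ t, w'' t + 3 * w t * w' t + w t ^ 3 + (a 2 + r 2 t) * (w' t + w t ^ 2) +
      (a 1 + r 1 t) * w t + (a 0 + r 0 t) = 0) : IsSolution a r y := by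
  have d1 : deriv y = fun t => w t * y t := funext fun t => (hy t).deriv
  have h2 (t : ℝ) : HasDerivAt (fun t => w t * y t) ((w' t + w t ^ 2) * y t) t :=
    ((hw t).mul (hy t)).congr_deriv (by ring)
  have d2 : deriv (fun t => w t * y t) = fun t => (w' t + w t ^ 2) * y t :=
    funext fun t => (h2 t).deriv
  have h3 (t : ℝ) : HasDerivAt (fun t => (w' t + w t ^ 2) * y t)
      ((w'' t + 3 * w t * w' t + w t ^ 3) * y t) t :=
    (((hw' t).add ((hw t).pow 2)).mul (hy t)).congr_deriv (by
      simp only [Pi.add_apply, Pi.pow_apply]; push_cast; ring)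
  have d3 : deriv (fun t => (w' t + w t ^ 2) * y t) =
      fun t => (w'' t + 3 * w t * w' t + w t ^ 3) * y t := funext fun t => (h3 t).deriv
  have cy : Continuous y := continuous_iff_continuousAt.2 fun t => (hy t).continuousAt
  have cw : Continuous w := continuous_iff_continuousAt.2 fun t => (hw t).continuousAt
  have cw' : Continuous w' := continuous_iff_continuousAt.2 fun t => (hw' t).continuousAt
  have c1 {f f' : ℝ → ℂ} {n : ℕ} (hf : ∀ t, HasDerivAt f (f' t) t) (hf' : ContDiff ℝ n f') :
      ContDiff ℝ (n + 1 : ℕ) f := by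
    rw [show ((n + 1 : ℕ) : WithTop ℕ∞) = (n : WithTop ℕ∞) + 1 by norm_cast, contDiff_succ_iff_deriv]
    refine ⟨fun t => (hf t).differentiableAt, by simp, ?_⟩
    rwa [show deriv f = f' from funext fun t => (hf t).deriv]
  refine ⟨c1 (n := 2) hy (c1 (n := 1) h2 (c1 (n := 0) h3 ?_)), fun t => ?_⟩
  · rw [Nat.cast_zero, contDiff_zero]
    fun_prop
  · rw [iteratedDeriv_succ, iteratedDeriv_succ, iteratedDeriv_one, d1, d2, d3]
    linear_combination y t * h t

/-- A bounded solution of the Riccati type integral equation gives a solution of the third order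
equation. -/
theorem isSolution_solutionFormula {a : Fin 3 → ℂ} {r : Fin 3 → ℝ → ℂ} {lam lam₁ lam₂ : ℂ}
    (hlam : (charPoly a).IsRoot lam) (hlam₁ : (charPoly a).IsRoot lam₁)
    (hlam₂ : (charPoly a).IsRoot lam₂) (h₁ : (lam₁ - lam).re ≠ 0) (h₂ : (lam₂ - lam).re ≠ 0)
    (h₁₂ : lam₁ ≠ lam₂) {z : ℝ → ℂ} (hz : SolvesRiccati a r lam lam₁ lam₂ z)
    (hF : riccatiTerm a r lam z ∈ BC) :
    IsSolution a r (solutionFormula lam (lam₁ - lam) (lam₂ - lam) (riccatiTerm a r lam z)) := by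
  have hγ : lam₁ - lam ≠ lam₂ - lam := fun h => h₁₂ (sub_left_injective h)
  obtain ⟨e₁, e₂, e₃⟩ := charPoly_roots hlam hlam₁ hlam₂ (fun h => h₁ (by simp [h]))
    (fun h => h₂ (by simp [h])) h₁₂
  set F := riccatiTerm a r lam z with hFdef
  set γ₁ := lam₁ - lam
  set γ₂ := lam₂ - lam
  have hG := hasDerivAt_green h₁ h₂ hγ hF
  have hG' := hasDerivAt_greenDeriv h₁ h₂ hγ hF
  have hdz : deriv z = fun t => -greenDeriv γ₁ γ₂ F t := by
    rw [show z = fun t => -green γ₁ γ₂ F t from funext hz.2]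
    exact funext fun t => (hG t).neg.deriv
  refine isSolution_of_logDeriv (w := fun t => lam - green γ₁ γ₂ F t)
    (w' := fun t => -greenDeriv γ₁ γ₂ F t)
    (w'' := fun t => -((γ₁ + γ₂) * greenDeriv γ₁ γ₂ F t - γ₁ * γ₂ * green γ₁ γ₂ F t + F t))
    (hasDerivAt_solutionFormula h₁ h₂ hγ hF) (fun t => (hG t).const_sub lam) (fun t => (hG' t).neg)
    ?_ fun t => ?_
  · have := (green_mem_BC h₁ h₂ hF).1
    have := (greenDeriv_mem_BC h₁ h₂ hF).1
    have := hF.1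
    fun_prop
  · have hFt : F t = pertPoly r lam t + linTerm r lam z t + nonlinTerm a r lam z t := rfl
    rw [hFt]
    simp only [pertPoly, linTerm, nonlinTerm, hdz, hz.2 t]
    -- With w = λ + z, the three coefficient identities cancel the linear terms in z' and z and the
    -- constant term; what remains is F - F.
    linear_combination (-(greenDeriv γ₁ γ₂ F t)) * e₁ - green γ₁ γ₂ F t * e₂ + e₃

/-! ## The decaying part of the solution of the Riccati type equation -/

theorem green_add {γ₁ γ₂ : ℂ} (h₁ : γ₁.re ≠ 0) (h₂ : γ₂.re ≠ 0) {f g : ℝ → ℂ} (hf : f ∈ BC)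
    (hg : g ∈ BC) (t : ℝ) :
    green γ₁ γ₂ (fun s => f s + g s) t = green γ₁ γ₂ f t + green γ₁ γ₂ g t := by
  have h := (green_sub h₁ h₂ (add_mem_BC hf hg) hg t).1
  simp only [add_sub_cancel_right] at h
  rw [h, sub_add_cancel]

theorem pNu_mem_BC {ν : Fin 3 → ℝ → ℂ} {lam : ℂ} {θ : ℝ → ℂ} (hν : ∀ i, ν i ∈ BC) (hθ : θ ∈ BC)
    (hdθ : deriv θ ∈ BC) : pNu ν lam θ ∈ BC :=
  add_mem_BC (add_mem_BC (add_mem_BC (add_mem_BC (add_mem_BC (const_mul_mem_BC _ (hν 2))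
    (const_mul_mem_BC _ (hν 1))) (hν 0)) (mul_mem_BC (add_mem_BC (const_mul_mem_BC _ (hν 2)) (hν 1))
    hθ)) (mul_mem_BC (hν 2) hdθ)) (mul_mem_BC (hν 2) (pow_mem_BC hθ 2))

theorem pNu_mem_decaying {p : ℝ} {c : Setting} {ν : Fin 3 → ℝ → ℂ} {lam : ℂ} {θ : ℝ → ℂ}
    (hν : ∀ i, ν i ∈ c.decaying p) (hθ : θ ∈ BC) (hdθ : deriv θ ∈ BC) :
    pNu ν lam θ ∈ c.decaying p := by
  have h := add_mem_decaying c (add_mem_decaying c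
    (mul_mem_decaying c (add_mem_BC (add_mem_BC (add_mem_BC (const_mem_BC (lam ^ 2))
      (const_mul_mem_BC (2 * lam) hθ)) hdθ) (pow_mem_BC hθ 2)) (hν 2))
    (mul_mem_decaying c (add_mem_BC (const_mem_BC lam) hθ) (hν 1))) (hν 0)
  convert! h using 1
  ext t
  simp only [pNu]
  ring

theorem rTheta_mem_BC {a : Fin 3 → ℂ} {r : Fin 3 → ℝ → ℂ} {lam : ℂ} {θ : ℝ → ℂ}
    (hr : ∀ i, r i ∈ BC) (hθ : θ ∈ BC) (hdθ : deriv θ ∈ BC) : rTheta a r lam θ ∈ BC :=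
  add_mem_BC (add_mem_BC (add_mem_BC (add_mem_BC (const_mul_mem_BC _ (hr 2)) (hr 1))
    (mul_mem_BC (const_mul_mem_BC 2 (add_mem_BC (const_mem_BC _) (hr 2))) hθ))
    (const_mul_mem_BC _ (pow_mem_BC hθ 2))) (const_mul_mem_BC _ hdθ)

theorem psiTerm_eq_pairTerm (a : Fin 3 → ℂ) (r ν : Fin 3 → ℝ → ℂ) (lam : ℂ) (θ ψ : ℝ → ℂ) :
    psiTerm a r ν lam θ ψ = pairTerm (pNu ν lam θ) (rTheta a r lam θ) (fun t => r 2 t + 3 * θ t)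
      (3 * lam + a 2) ψ (deriv ψ) := by
  ext t
  simp only [psiTerm, pairTerm]
  ring

/-- Polynomial expansion around θ. It explains the shape of P_ν and r_θ: what involves ν and θ alone
is the inhomogeneity, and the coefficient of ψ is r_θ. -/
theorem riccatiTerm_add (a : Fin 3 → ℂ) {r μ ν : Fin 3 → ℝ → ℂ} (hr : ∀ i, r i = μ i + ν i)
    (lam : ℂ) {θ ψ : ℝ → ℂ} (hθ : Differentiable ℝ θ) (hψ : Differentiable ℝ ψ) :
    riccatiTerm a r lam (θ + ψ) = fun t => riccatiTerm a μ lam θ t + psiTerm a r ν lam θ ψ t := by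
  ext t
  have hd : deriv (θ + ψ) t = deriv θ t + deriv ψ t := deriv_add (hθ t) (hψ t)
  simp only [riccatiTerm, pertPoly, linTerm, nonlinTerm, psiTerm, pNu, rTheta, hd, hr, Pi.add_apply]
  ring

theorem isBigO_top_of_enorm_le {f : ℝ → ℂ} {E : ℝ → ℝ≥0∞} {C : ℝ≥0∞} (hC : C ≠ ⊤)
    (hE : ∀ t, E t ≠ ⊤) (h : ∀ t, ‖f t‖ₑ ≤ C * E t) : f =O[⊤] fun t => (E t).toReal := by
  refine Asymptotics.IsBigO.of_bound C.toReal (eventually_top.2 fun t => ?_)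
  rw [Real.norm_of_nonneg ENNReal.toReal_nonneg, ← ENNReal.toReal_mul, ← toReal_enorm]
  exact ENNReal.toReal_mono (ENNReal.mul_ne_top hC (hE t)) (h t)

end PoincarePerron

theorem theorem3p6 (a : Fin 3 → ℂ) (lam lam₁ lam₂ : ℂ)
    (hlam : (charPoly a).IsRoot lam) (hlam₁ : (charPoly a).IsRoot lam₁)
    (hlam₂ : (charPoly a).IsRoot lam₂)
    (hre₁ : lam₁.re ≠ lam.re) (hre₂ : lam₂.re ≠ lam.re) (hre₁₂ : lam₁.re ≠ lam₂.re)
    (p : ℝ) (hp : 1 ≤ p) (c : Setting)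
    (r μ ν : Fin 3 → ℝ → ℂ) (hr : ∀ i, r i = μ i + ν i)
    (hrc : ∀ i, r i ∈ c.apType p) (hμ : ∀ i, μ i ∈ AP) (hν : ∀ i, ν i ∈ c.decaying p)
    (θ : ℝ → ℂ) (hθ : θ ∈ AP) (hθeq : SolvesRiccati a μ lam lam₁ lam₂ θ)
    (hL : Lconst a r lam lam₁ lam₂ 0 θ < 1)
    (hH : supNorm (green (lam₁ - lam) (lam₂ - lam) (pNu ν lam θ))
        + supNorm (deriv (green (lam₁ - lam) (lam₂ - lam) (pNu ν lam θ)))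
      ≤ ENNReal.ofReal (smallnessBound (Lconst a r lam lam₁ lam₂ 0 θ).toReal
          (Qconst a r lam lam₁ lam₂ 0 θ).toReal)) :
    ∃ ψ z y : ℝ → ℂ,
      -- the solution `y` and its representation through `z = θ + ψ`
      IsSolution a r y ∧
      (∀ t, y t = solutionFormula lam (lam₁ - lam) (lam₂ - lam) (riccatiTerm a r lam z) t) ∧
      z = θ + ψ ∧ SolvesRiccati a r lam lam₁ lam₂ z ∧
      z ∈ c.apType p ∧ deriv z ∈ c.apType p ∧
      -- the decaying part `ψ`
      ContDiff ℝ 1 ψ ∧ ψ ∈ c.decaying p ∧ deriv ψ ∈ c.decaying p ∧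
      (∀ t, ψ t = -green (lam₁ - lam) (lam₂ - lam) (psiTerm a r ν lam θ ψ) t) ∧
      -- the estimate, uniform on the whole line
      ∀ β : ℝ, 0 < β → β < min |(lam₁ - lam).re| |(lam₂ - lam).re| →
        Lconst a r lam lam₁ lam₂ β θ < 1 / 2 →
        (ψ =O[⊤] fun t =>
          (absGreen (β : ℂ) (pNu ν lam θ) t + absGreen (-(β : ℂ)) (pNu ν lam θ) t).toReal) ∧
        (deriv ψ =O[⊤] fun t =>
          (absGreen (β : ℂ) (pNu ν lam θ) t + absGreen (-(β : ℂ)) (pNu ν lam θ) t).toReal) := by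
  have h₁ : (lam₁ - lam).re ≠ 0 := by simpa [sub_eq_zero] using hre₁
  have h₂ : (lam₂ - lam).re ≠ 0 := by simpa [sub_eq_zero] using hre₂
  have hne : lam₁ ≠ lam₂ := fun h => hre₁₂ (by rw [h])
  have hγ : lam₁ - lam ≠ lam₂ - lam := fun h => hne (sub_left_injective h)
  have ha₁ : (0 : ℝ) < |(lam₁ - lam).re| := abs_pos.2 h₁
  have ha₂ : (0 : ℝ) < |(lam₂ - lam).re| := abs_pos.2 h₂
  have hrBC (i) : r i ∈ BC := mem_BC_of_mem_apType c (hrc i)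
  have hμBC (i) : μ i ∈ BC := mem_BC_of_mem_AP (hμ i)
  -- Even in the Lᵖ settings ν is bounded and continuous, being the difference of r and μ.
  have hνBC (i) : ν i ∈ BC := by
    have h := sub_mem_BC (hrBC i) (hμBC i)
    rw [hr i] at h
    simpa using h
  have hθBC := mem_BC_of_mem_AP hθ
  have hLs := ENNReal.add_ne_top.1 (hL.trans ENNReal.one_lt_top).ne
  obtain ⟨C₁, hC₁, hC₁'⟩ := exists_absGreen_deriv_le hne hrBC hθBC h₁ hLs.1
  obtain ⟨C₂, hC₂, hC₂'⟩ := exists_absGreen_deriv_le hne hrBC hθBC h₂ hLs.2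
  obtain ⟨hdθ, hFθ, K, hK⟩ := hθeq.regularity h₁ h₂ hγ hμBC hθBC (C := C₁ + C₂)
    (ENNReal.add_ne_top.2 ⟨hC₁, hC₂⟩) (fun t => (hC₁' t).trans le_self_add)
    (fun t => (hC₂' t).trans le_add_self)
  have hdθAP : deriv θ ∈ AP := deriv_mem_AP hθ (fun t => (hθeq.1 t).hasDerivAt) hK
  have hP : pNu ν lam θ ∈ BC := pNu_mem_BC hνBC hθBC hdθ
  have hPc : pNu ν lam θ ∈ c.decaying p := pNu_mem_decaying hν hθBC hdθ
  have hR : rTheta a r lam θ ∈ BC := rTheta_mem_BC hrBC hθBC hdθ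
  have hB : (fun t => r 2 t + 3 * θ t) ∈ BC := add_mem_BC (hrBC 2) (const_mul_mem_BC 3 hθBC)
  have hc : 1 + ‖3 * lam + a 2‖ ≤ 1 + 3 * ‖lam‖ + ‖a 2‖ := by
    have := norm_add_le (3 * lam) (a 2)
    rw [norm_mul, Complex.norm_ofNat] at this
    linarith
  set L := Lconst a r lam lam₁ lam₂ 0 θ with hLdef
  set Q := Qconst a r lam lam₁ lam₂ 0 θ with hQdef
  have hLt : L ≠ ⊤ := (hL.trans ENNReal.one_lt_top).ne
  have hQt : Q ≠ ⊤ := Qconst_ne_top h₁ h₂ ha₁ ha₂ hB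
  have hL1 : L.toReal < 1 := by
    simpa using (ENNReal.toReal_lt_toReal hLt ENNReal.one_ne_top).2 hL
  have hQ0 : 0 < Q.toReal := ENNReal.toReal_pos (Qconst_zero_pos h₁ hne).ne' hQt
  obtain ⟨hM, hM1, hM2⟩ := Mconst_pos_and_identities hL1 hQ0
  set M := Mconst L.toReal Q.toReal
  have hbL (t) := majorant_le_Lconst (lam₁ := lam₁) (lam₂ := lam₂) (β := 0) hR.1.measurable t
  have hbQ (t) := majorant_le_Qconst (a := a) (r := r) h₁ h₂ ha₁ ha₂ (θ := θ) t
  rw [← hLdef] at hbL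
  rw [← hQdef] at hbQ
  have hsmall (t : ℝ) : ‖green (lam₁ - lam) (lam₂ - lam) (pNu ν lam θ) t‖ +
      ‖greenDeriv (lam₁ - lam) (lam₂ - lam) (pNu ν lam θ) t‖ ≤
      Q.toReal * (6 * M ^ 3 + 3 * M ^ 2) := by
    rw [show deriv (green (lam₁ - lam) (lam₂ - lam) (pNu ν lam θ)) =
      greenDeriv (lam₁ - lam) (lam₂ - lam) (pNu ν lam θ) from
      funext fun t => (hasDerivAt_green h₁ h₂ hγ hP t).deriv, hM2] at hH
    rw [← ENNReal.ofReal_le_ofReal_iff (by positivity),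
      ENNReal.ofReal_add (norm_nonneg _) (norm_nonneg _), ofReal_norm, ofReal_norm]
    exact (add_le_add (le_iSup (fun t => ‖green (lam₁ - lam) (lam₂ - lam) (pNu ν lam θ) t‖ₑ) t)
      (le_iSup (fun t => ‖greenDeriv (lam₁ - lam) (lam₂ - lam) (pNu ν lam θ) t‖ₑ) t)).trans hH
  -- Both conditions follow from L + Q(9M²+6M) = 1. The contraction needs L + Q(3M²+3M) < 1; the
  -- self-map needs LM + Q(7M³+4M²) ≤ M, while M = LM + Q(9M³+6M²).
  obtain ⟨ψ, v, hψBC, hvBC, hψv, hψ, hv⟩ := exists_fixedPoint_pair h₁ h₂ hP hR hB hc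
    ENNReal.toReal_nonneg ENNReal.toReal_nonneg hM.le
    (fun t => (hbL t).trans_eq (ENNReal.ofReal_toReal hLt).symm)
    (fun t => (hbQ t).trans_eq (ENNReal.ofReal_toReal hQt).symm)
    (by nlinarith [mul_pos hQ0 hM, mul_pos hQ0 (pow_pos hM 2)]) hsmall
    (by nlinarith [mul_pos hQ0 (pow_pos hM 2), mul_pos hQ0 (pow_pos hM 3)])
  have hpairBC := pairTerm_mem_BC hP hR hB (3 * lam + a 2) hψBC hvBC
  have hdψ (t : ℝ) : HasDerivAt ψ (v t) t := by
    rw [funext hψ, hv t]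
    exact (hasDerivAt_green h₁ h₂ hγ hpairBC t).neg
  -- The second fixed point equation identifies v with ψ', turning the system back into the equation
  -- for ψ.
  obtain rfl : v = deriv ψ := funext fun t => (hdψ t).deriv.symm
  have hψd : Differentiable ℝ ψ := fun t => (hdψ t).differentiableAt
  have hψe (t : ℝ) : ‖ψ t‖ₑ + ‖deriv ψ t‖ₑ ≤ ENNReal.ofReal M := by
    rw [← ofReal_norm, ← ofReal_norm, ← ENNReal.ofReal_add (norm_nonneg _) (norm_nonneg _)]
    exact ENNReal.ofReal_le_ofReal (hψv t)
  have hψm (t : ℝ) : ‖ψ t‖ₑ + ‖deriv ψ t‖ₑ ≤ majorant (lam₁ - lam) (lam₂ - lam) 0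
      (fun s => ‖pairTerm (pNu ν lam θ) (rTheta a r lam θ) (fun t => r 2 t + 3 * θ t)
        (3 * lam + a 2) ψ (deriv ψ) s‖ₑ) t := by
    rw [hψ t, hv t, enorm_neg, enorm_neg]
    exact enorm_green_add_enorm_greenDeriv_le h₁ h₂ _ t
  obtain ⟨δ, hδ, D, hD, hψD⟩ := exists_rate_pair_le_expConv h₁ h₂ hP hR hB hc hM.le hbL hbQ
    (by
      rw [← ENNReal.ofReal_toReal hLt, ← ENNReal.ofReal_toReal hQt, ← ENNReal.ofReal_mul (by positivity),
        ← ENNReal.ofReal_add ENNReal.toReal_nonneg (by positivity), ENNReal.ofReal_lt_one]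
      nlinarith [mul_pos hQ0 hM, mul_pos hQ0 (pow_pos hM 2)]) hψe hψm
  have hψc : ψ ∈ c.decaying p := mem_decaying_of_le_expConv hp c hδ hψBC hP hPc hD
    fun t => le_self_add.trans (hψD t)
  have hdψc : deriv ψ ∈ c.decaying p := mem_decaying_of_le_expConv hp c hδ hvBC hP hPc hD
    fun t => le_add_self.trans (hψD t)
  have hψterm := psiTerm_eq_pairTerm a r ν lam θ ψ
  have hFz := riccatiTerm_add a hr lam hθeq.1 hψd
  have hFzBC : riccatiTerm a r lam (θ + ψ) ∈ BC := by
    rw [hFz, hψterm]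
    exact add_mem_BC hFθ hpairBC
  have hz : SolvesRiccati a r lam lam₁ lam₂ (θ + ψ) := by
    refine ⟨hθeq.1.add hψd, fun t => ?_⟩
    rw [hFz, hψterm, green_add h₁ h₂ hFθ hpairBC, neg_add, ← hθeq.2 t, ← hψ t, Pi.add_apply]
  have hdz : deriv (θ + ψ) = deriv θ + deriv ψ :=
    funext fun t => deriv_add (hθeq.1 t) (hψd t)
  refine ⟨ψ, θ + ψ, _, isSolution_solutionFormula hlam hlam₁ hlam₂ h₁ h₂ hne hz hFzBC,
    fun t => rfl, rfl, hz, add_mem_apType c hθ hψBC hψc, ?_, contDiff_one_iff_deriv.2 ⟨hψd, hvBC.1⟩,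
    hψc, hdψc, fun t => by rw [hψterm]; exact hψ t, fun β hβ hβm hβL => ?_⟩
  · rw [hdz]
    exact add_mem_apType c hdθAP hvBC hdψc
  · obtain ⟨hβ₁, hβ₂⟩ := lt_min_iff.1 hβm
    -- The rate δ found above feeds the bootstrap, after which only the linear part has to be
    -- contractive at rate β.
    obtain ⟨C, hC, hψC⟩ := pair_le_expConv h₁ h₂ hP hR hB hc hM.le hβ.le hβ₁ hβ₂
      (hβL.trans (by simp)) (Qconst_ne_top h₁ h₂ hβ₁ hβ₂ hB)
      (fun t => majorant_le_Lconst hR.1.measurable t) (fun t => majorant_le_Qconst h₁ h₂ hβ₁ hβ₂ t)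
      hψBC hvBC hψe hψm hδ hD hψD
    simp_rw [expConv_enorm_eq hβ hP.1.measurable] at hψC
    have hE (t : ℝ) : absGreen (β : ℂ) (pNu ν lam θ) t + absGreen (-(β : ℂ)) (pNu ν lam θ) t ≠ ⊤ :=
      ENNReal.add_ne_top.2 ⟨absGreen_ne_top_of_mem_BC (by simpa using hβ.ne') hP t,
        absGreen_ne_top_of_mem_BC (by simpa using hβ.ne') hP t⟩
    exact ⟨isBigO_top_of_enorm_le hC hE fun t => le_self_add.trans (hψC t),
      isBigO_top_of_enorm_le hC hE fun t => le_add_self.trans (hψC t)⟩
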